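/- Let $K$ be a field of characteristic $0$ (for example $\mathbb R$ or $\mathbb C$) and let $\lambda\neq\mu$ in $K$. Write $z_c:=z-c$ and $z_{\mu,\lambda}:=z_\mu z_\lambda$. Below, $n$ runs over the integers $n\ge 0$, and quantities with negative lower index are $0$. For $A_n^{s,t},B_n^{s,t},C_n^{s,t},D_n^{s,t}\in K$, the Lax pair for a wave function $\psi_n^{s,t}$ with values in a commutative $K$-algebra $R$ containing the spectral parameter $z$ is $$z_\lambda \psi_n^{s,t+1}-z_\mu \psi_n^{s+1,t}=z_{\mu,\lambda}A_n^{s,t}\psi_{n-1}^{s+1,t+1}-B_n^{s,t}\psi_n^{s,t},\qquad z_{\mu,\lambda}\psi_n^{s+1,t+1}-\psi_{n+1}^{s,t}=z_\lambda C_n^{s,t}\psi_n^{s,t+1}-z_\mu D_n^{s,t}\psi_n^{s+1,t}. \tag{L}$$ The discrete Pfaff lattice is the system, with boundary condition $A_0^{s,t}=0$, $$A_n^{s+1,t+1}-A_{n+1}^{s,t}+B_{n+1}^{s,t}-B_n^{s+1,t+1}=C_n^{s,t+1}-C_n^{s+1,t}+D_n^{s+1,t}-D_n^{s,t+1}\quad(n\ge0),$$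 $$A_n^{s+1,t}C_{n-1}^{s+1,t}=A_n^{s,t}C_n^{s,t},\qquad A_n^{s,t+1}D_{n-1}^{s,t+1}=A_n^{s,t}D_n^{s,t}\quad(n\ge1),$$ $$B_n^{s+1,t}D_n^{s+1,t}=B_{n+1}^{s,t}D_n^{s,t},\qquad B_n^{s,t+1}C_n^{s,t+1}=B_{n+1}^{s,t}C_n^{s,t}\quad(n\ge0). \tag{P}$$ (1) Compatibility gives the system. Let $s,t\in\mathbb Z$ and $A_0^{s,t}=0$. Suppose that (L) has a wave function in general position: for all $n,s,t$ the elements $z_{\mu,\lambda}\psi_n^{s+1,t+1}$, $z_\lambda\psi_n^{s,t+1}$, $z_\mu\psi_n^{s+1,t}$ and, if $n\ge1$, also $z_\mu z_\lambda^2\psi_{n-1}^{s+1,t+2}$, $z_\mu^2z_\lambda\psi_{n-1}^{s+2,t+1}$ are linearly independent over $K$. Then $A,B,C,D$ satisfy (P). Conversely, if $A,B,C,D$ satisfy (P) for $s,t\in\mathbb Z$, then (L) is compatible: every $\psi_0^{s,t}$ with $z_\lambda\psi_0^{s,t+1}-z_\mu\psi_0^{s+1,t}=-B_0^{s,t}\psi_0^{s,t}$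 extends to exactly one wave function of (L). (2) The system is a nonlinear form of the discrete coupled KP equation $$z_{\mu,\lambda}(\lambda-\mu)\tau_{n+1}^{s,t}\hat\tau_n^{s+1,t+1}=z_\lambda\tau_{n+1}^{s+1,t}\hat\tau_n^{s,t+1}-z_\mu\tau_{n+1}^{s,t+1}\hat\tau_n^{s+1,t}+(\lambda-\mu)\tau_n^{s+1,t+1}\hat\tau_{n+1}^{s,t},$$ $$(\lambda-\mu)\tau_n^{s+1,t+1}\hat\tau_n^{s,t}=z_\mu\tau_n^{s,t+1}\hat\tau_n^{s+1,t}-z_\lambda\tau_n^{s+1,t}\hat\tau_n^{s,t+1}+z_{\mu,\lambda}(\lambda-\mu)\tau_{n+1}^{s,t}\hat\tau_{n-1}^{s+1,t+1}. \tag{K}$$ For $\kappa\ne0$ and nowhere vanishing $\tau_n^{s,t}\in K$ put $$A_n^{s,t}=\kappa\frac{\tau_{n+1}^{s,t}\tau_{n-1}^{s+1,t+1}}{\tau_n^{s+1,t}\tau_n^{s,t+1}},\quad B_n^{s,t}=\kappa\frac{\tau_n^{s,t}\tau_n^{s+1,t+1}}{\tau_n^{s+1,t}\tau_n^{s,t+1}},\quad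 C_n^{s,t}=\kappa^{-1}\frac{\tau_{n+1}^{s+1,t}\tau_n^{s,t+1}}{\tau_{n+1}^{s,t}\tau_n^{s+1,t+1}},\quad D_n^{s,t}=\kappa^{-1}\frac{\tau_{n+1}^{s,t+1}\tau_n^{s+1,t}}{\tau_{n+1}^{s,t}\tau_n^{s+1,t+1}}. \tag{S$_\kappa$}$$ Then for any $R$-valued $\hat\tau$, the pair $(\tau,\hat\tau)$ satisfies (K) if and only if $\psi_n^{s,t}=\hat\tau_n^{s,t}/\tau_n^{s,t}$ satisfies (L) with the coefficients (S$_{\lambda-\mu}$); and if (K) holds and $z_{\mu,\lambda}\hat\tau_n^{s+1,t+1}\neq0$ for all $n,s,t$, then (S$_{\lambda-\mu}$) satisfies (P). Here, and in (3), $s,t$ may run over $\mathbb N$ or over $\mathbb Z$. (3) Special Pfaffian solution. Let $\langle\cdot|\cdot\rangle^{s,t}$ be skew-symmetric bilinear forms on $K[z]$ with $$\langle f|g\rangle^{s+1,t}=\langle (z-\mu)f|(z-\mu)g\rangle^{s,t},\qquad \langle f|g\rangle^{s,t+1}=\langle (z-\lambda)f|(z-\lambda)g\rangle^{s,t},$$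 each of which has monic skew orthogonal polynomials $q_n^{s,t}$, $n\ge 0$: $\deg q_n^{s,t}=n$, $\langle q_{2m}^{s,t}|q_{2n+1}^{s,t}\rangle^{s,t}=r_n^{s,t}\delta_{mn}$ with $r_n^{s,t}\neq0$, and $\langle q_{2m}^{s,t}|q_{2n}^{s,t}\rangle^{s,t}=\langle q_{2m+1}^{s,t}|q_{2n+1}^{s,t}\rangle^{s,t}=0$. Let $\tau_n^{s,t}=\mathrm{Pf}(0,1,\dots,2n-1)$ and $\hat\tau_n^{s,t}=\mathrm{Pf}(0,1,\dots,2n,z)$ be the Pfaffians with elements $\mathrm{Pf}(i,j)=\langle z^i|z^j\rangle^{s,t}$, $\mathrm{Pf}(i,z)=-\mathrm{Pf}(z,i)=z^i$. Then $\tau_n^{s,t}\ne0$, $\hat\tau_n^{s,t}=\tau_n^{s,t}q_{2n}^{s,t}$, and $(\tau,\hat\tau)$ satisfies (K); $\psi_n^{s,t}=q_{2n}^{s,t}(z)$ is a wave function of (L) with coefficients (S$_{\lambda-\mu}$), it is in general position in the sense of (1); and both (S$_{\mu-\lambda}$) and (S$_{\lambda-\mu}$) are solutions of (P). -/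

import Mathlib

open Polynomial

namespace SkewOrth

/-- The Pfaffian of a `2n × 2n` array `a` over a commutative `ℚ`-algebra,
`∑_σ sgn(σ) / (n! 2^n) ∏_{i<n} a (σ(2i)) (σ(2i+1))`. -/
noncomputable def pfaffian {R : Type*} [CommRing R] [Algebra ℚ R] (n : ℕ)
    (a : Fin (2 * n) → Fin (2 * n) → R) : R :=
  (1 / ((n.factorial : ℚ) * 2 ^ n)) •
    ∑ p : Equiv.Perm (Fin (2 * n)),
      ((Equiv.Perm.sign p : ℤ) : R) *
        ∏ i : Fin n, a (p ⟨2 * i, by omega⟩) (p ⟨2 * i + 1, by omega⟩)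

/-- The sequence `n ↦ f (n - 1)`, with the convention that terms of negative index are `0`. -/
def below {X : Type*} [Zero X] {σ : Type*} (f : ℕ → σ → σ → X) : ℕ → σ → σ → X
  | 0 => fun _ _ => 0
  | n + 1 => f n

/-! ### The Lax pair and the nonlinear system

Throughout, `X n s t` stands for `X_n^{s,t}`; `n` runs over the nonnegative integers, and `s`, `t`
over an index set `σ` with a shift `s ↦ s + 1` (in practice `ℕ` or `ℤ`). -/

section Lax

variable {K : Type*} [Field K] {R : Type*} [CommRing R] [Algebra K R] {σ : Type*} [Add σ] [One σ]

/-- `z - c` in the `K`-algebra `R`. -/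
def shiftBy (z : R) (c : K) : R := z - algebraMap K R c

/-- `q` is a wave function, with spectral parameter `z`, of the Lax pair with coefficients
`A, B, C, D`; by convention the wave function vanishes for negative `n`. -/
structure IsWaveFunction (lam mu : K) (z : R) (A B C D : ℕ → σ → σ → K)
    (q : ℕ → σ → σ → R) : Prop where
  first : ∀ n s t,
    shiftBy z lam * q n s (t + 1) - shiftBy z mu * q n (s + 1) t
      = shiftBy z mu * shiftBy z lam * (A n s t • below q n (s + 1) (t + 1)) - B n s t • q n s t
  second : ∀ n s t,
    shiftBy z mu * shiftBy z lam * q n (s + 1) (t + 1) - q (n + 1) s t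
      = shiftBy z lam * (C n s t • q n s (t + 1)) - shiftBy z mu * (D n s t • q n (s + 1) t)

/-- At each lattice site, the values of the wave function in terms of which the Lax pair expresses
all the others that enter the compatibility check (three of them for `n = 0`, five for `n ≥ 1`)
satisfy no linear relation with constant (that is, `z`-independent) coefficients. -/
structure InGeneralPosition (lam mu : K) (z : R) (q : ℕ → σ → σ → R) : Prop where
  zero : ∀ s t, LinearIndependent K
    ![shiftBy z mu * shiftBy z lam * q 0 (s + 1) (t + 1),
      shiftBy z lam * q 0 s (t + 1),
      shiftBy z mu * q 0 (s + 1) t]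
  succ : ∀ n s t, LinearIndependent K
    ![shiftBy z mu * shiftBy z lam * q (n + 1) (s + 1) (t + 1),
      shiftBy z lam * q (n + 1) s (t + 1),
      shiftBy z mu * q (n + 1) (s + 1) t,
      shiftBy z mu * shiftBy z lam ^ 2 * q n (s + 1) (t + 1 + 1),
      shiftBy z mu ^ 2 * shiftBy z lam * q n (s + 1 + 1) (t + 1)]

/-- The nonlinear difference system for `A, B, C, D` on the semi-infinite lattice `n ≥ 0`, with the
boundary condition `A_0 = 0`. -/
structure DiscretePfaffLattice (A B C D : ℕ → σ → σ → K) : Prop where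
  boundary : ∀ s t, A 0 s t = 0
  additive : ∀ n s t,
    A n (s + 1) (t + 1) - A (n + 1) s t + B (n + 1) s t - B n (s + 1) (t + 1)
      = C n s (t + 1) - C n (s + 1) t + D n (s + 1) t - D n s (t + 1)
  mulAC : ∀ n s t, A (n + 1) (s + 1) t * C n (s + 1) t = A (n + 1) s t * C (n + 1) s t
  mulAD : ∀ n s t, A (n + 1) s (t + 1) * D n s (t + 1) = A (n + 1) s t * D (n + 1) s t
  mulBD : ∀ n s t, B n (s + 1) t * D n (s + 1) t = B (n + 1) s t * D n s t
  mulBC : ∀ n s t, B n s (t + 1) * C n s (t + 1) = B (n + 1) s t * C n s t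

/-- The discrete coupled KP equation for `τ` and `τ̂`, with `z` as spectral parameter. -/
structure DiscreteCoupledKP (lam mu : K) (z : R) (tau : ℕ → σ → σ → K)
    (tauHat : ℕ → σ → σ → R) : Prop where
  first : ∀ n s t,
    shiftBy z mu * shiftBy z lam * (((lam - mu) * tau (n + 1) s t) • tauHat n (s + 1) (t + 1))
      = shiftBy z lam * (tau (n + 1) (s + 1) t • tauHat n s (t + 1))
        - shiftBy z mu * (tau (n + 1) s (t + 1) • tauHat n (s + 1) t)
        + ((lam - mu) * tau n (s + 1) (t + 1)) • tauHat (n + 1) s t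
  second : ∀ n s t,
    ((lam - mu) * tau n (s + 1) (t + 1)) • tauHat n s t
      = shiftBy z mu * (tau n s (t + 1) • tauHat n (s + 1) t)
        - shiftBy z lam * (tau n (s + 1) t • tauHat n s (t + 1))
        + shiftBy z mu * shiftBy z lam *
            (((lam - mu) * tau (n + 1) s t) • below tauHat n (s + 1) (t + 1))

end Lax

/-! ### The coefficients in terms of `τ`; `κ` is the constant prefactor -/

section Coefficients

variable {K : Type*} [Field K] {σ : Type*} [Add σ] [One σ]

/-- `A_n = κ τ_{n+1} τ_{n-1}^{s+1,t+1} / (τ_n^{s+1,t} τ_n^{s,t+1})`, where `τ_{-1} = 0`. -/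
def coeffA (κ : K) (tau : ℕ → σ → σ → K) (n : ℕ) (s t : σ) : K :=
  κ * (tau (n + 1) s t * below tau n (s + 1) (t + 1) / (tau n (s + 1) t * tau n s (t + 1)))

/-- `B_n = κ τ_n τ_n^{s+1,t+1} / (τ_n^{s+1,t} τ_n^{s,t+1})`. -/
def coeffB (κ : K) (tau : ℕ → σ → σ → K) (n : ℕ) (s t : σ) : K :=
  κ * (tau n s t * tau n (s + 1) (t + 1) / (tau n (s + 1) t * tau n s (t + 1)))

/-- `C_n = κ⁻¹ τ_{n+1}^{s+1,t} τ_n^{s,t+1} / (τ_{n+1} τ_n^{s+1,t+1})`. -/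
def coeffC (κ : K) (tau : ℕ → σ → σ → K) (n : ℕ) (s t : σ) : K :=
  κ⁻¹ * (tau (n + 1) (s + 1) t * tau n s (t + 1) / (tau (n + 1) s t * tau n (s + 1) (t + 1)))

/-- `D_n = κ⁻¹ τ_{n+1}^{s,t+1} τ_n^{s+1,t} / (τ_{n+1} τ_n^{s+1,t+1})`. -/
def coeffD (κ : K) (tau : ℕ → σ → σ → K) (n : ℕ) (s t : σ) : K :=
  κ⁻¹ * (tau (n + 1) s (t + 1) * tau n (s + 1) t / (tau (n + 1) s t * tau n (s + 1) (t + 1)))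

end Coefficients

/-! ### Skew-inner products, skew orthogonal polynomials and their Pfaffians -/

section Skew

variable {K : Type*} [Field K]

/-- A skew-inner product on `K[z]`: a bilinear form with `⟨f|g⟩ = -⟨g|f⟩`. -/
def IsSkew (b : K[X] →ₗ[K] K[X] →ₗ[K] K) : Prop := ∀ f g, b f g = -b g f

/-- `q` is a sequence of monic skew orthogonal polynomials with respect to `b`. -/
structure IsMonicSOP (b : K[X] →ₗ[K] K[X] →ₗ[K] K) (q : ℕ → K[X]) : Prop where
  monic : ∀ n, (q n).Monic
  natDegree : ∀ n, (q n).natDegree = n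
  even_odd : ∃ r : ℕ → K, (∀ n, r n ≠ 0) ∧
    ∀ m n, b (q (2 * m)) (q (2 * n + 1)) = if m = n then r n else 0
  even_even : ∀ m n, b (q (2 * m)) (q (2 * n)) = 0
  odd_odd : ∀ m n, b (q (2 * m + 1)) (q (2 * n + 1)) = 0

variable [CharZero K]

/-- `τ_n = Pf(0, 1, …, 2n-1)` with `Pf(i, j) = ⟨z^i | z^j⟩`. -/
noncomputable def pfTau (b : K[X] →ₗ[K] K[X] →ₗ[K] K) (n : ℕ) : K :=
  pfaffian n fun i j => b (X ^ (i : ℕ)) (X ^ (j : ℕ))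

/-- `τ̂_n = Pf(0, 1, …, 2n, z)` with `Pf(i, j) = ⟨z^i | z^j⟩`, `Pf(i, z) = -Pf(z, i) = z^i`; the
symbol `z` is the last index, namely `2n + 1`. -/
noncomputable def pfTauHat (b : K[X] →ₗ[K] K[X] →ₗ[K] K) (n : ℕ) : K[X] :=
  pfaffian (n + 1) fun i j =>
    if (i : ℕ) ≤ 2 * n then
      if (j : ℕ) ≤ 2 * n then Polynomial.C (b (X ^ (i : ℕ)) (X ^ (j : ℕ))) else X ^ (i : ℕ)
    else
      if (j : ℕ) ≤ 2 * n then -X ^ (j : ℕ) else 0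

end Skew

end SkewOrth

/-!
The Lax pair is compatible exactly when a linear relation among a few of its values holds at each
site: the second equation expresses `q (n + 2)` by `q (n + 1)`, and substituting this into the first
equation at `n + 2` leaves a combination of the shifts of `q (n + 1)` by `(s+1, t+1)`, `(s, t+1)`
and `(s+1, t)` and of two shifts of `q n`. Its coefficients are the defects of the equations of the
lattice (`IsWaveFunction.relation_succ`). In general position these defects vanish; conversely, if
they vanish, the first equation propagates from each `n` to `n + 1`. With coefficients coming from a
`τ`-function the multiplicative equations are identities, so that only the additive defect is left,
and it vanishes as soon as the value it multiplies is not zero. Multiplying the Lax pair by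
denominators gives the coupled KP equation.

For the Pfaffian solution no Pfaffian identities are needed beyond `τ_{n+1} = r_n τ_n` and
`τ̂_n = τ_n q_{2n}`. Both follow from `Pf (M a Mᵀ) = det M · Pf a` (`pfaffian_conj`), which allows
a unitriangular change of basis to the `q_i`, and from the expansion along a row with a single
nonzero entry (`pfaffian_succ`). The rest is orthogonality. Let a prime denote the shift by
`z - c`, and `ρ_n = ⟨(z - c) q'_{2n} | 1⟩`. Pairing `(z - c) q'_{2n}` with `q_{2n}` and with
`q_{2n+2}` yields `q_{2n}(c) ρ_n = -r_n` and `q_{2n+2}(c) ρ_n = -r'_n`, hence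
`q_{2n}(c) = τ'_n / τ_n` and `ρ_n = -τ_{n+1} / τ'_n`. In particular the values of `q_{2n}` at
`mu` and `lam` are not zero, which gives general position.

To check a Lax equation, let `E` be the difference of its sides. The formulas for the values of
`q_{2n}` say that `E` vanishes at `mu` and `lam`, so `E = (z - mu) (z - lam) f`, and `E` is
orthogonal to the multiples of `(z - mu) (z - lam)` of low degree, so that `f` is orthogonal to all
polynomials of low degree for the form shifted in both directions. Nondegeneracy gives `f = 0` for
the second equation. For the first equation `f` is a multiple of the shifted `q_{2n-2}`, and pairing
`E` with `z - lam` shows that this multiple is zero (`IsShiftSquare.second_lax`,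
`IsShiftSquare.first_lax_succ`).
-/

namespace SkewOrth

/-! ### Pfaffians -/

section Pfaffian

variable {R S : Type*} [CommRing R] [CommRing S]

theorem prod_pairs {M : Type*} [CommMonoid M] (n : ℕ) (g : Fin (2 * n) → M) :
    ∏ j, g j = ∏ i : Fin n, g ⟨2 * i, by omega⟩ * g ⟨2 * i + 1, by omega⟩ := by
  have h : ∀ k (hk : k = n * 2) (g : Fin k → M), ∏ j, g j =
      ∏ i : Fin n, g ⟨2 * i, by omega⟩ * g ⟨2 * i + 1, by omega⟩ := by
    intro k hk g
    subst hk
    rw [← finProdFinEquiv.prod_comp, Fintype.prod_prod_type]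
    refine Finset.prod_congr rfl fun i _ => ?_
    rw [Fin.prod_univ_two]
    congr 2 <;> ext <;> simp [finProdFinEquiv, add_comm]
  exact h _ (mul_comm _ _) g

theorem pfaffian_map [Algebra ℚ R] [Algebra ℚ S] (f : R →+* S) (n : ℕ)
    (a : Fin (2 * n) → Fin (2 * n) → R) :
    f (pfaffian n a) = pfaffian n fun i j => f (a i j) := by
  unfold pfaffian
  rw [map_rat_smul f]
  simp [map_sum, map_mul, map_prod]

/-- `Pf (M a Mᵀ) = det M · Pf a`. Expanding the products turns the left-hand side into a sum over
all maps `φ` from `Fin (2 * n)` to itself, in which `φ` contributes the determinant of the columns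
of `M` selected by `φ`; only bijective `φ` survive. -/
theorem pfaffian_conj [Algebra ℚ R] (n : ℕ) (M : Matrix (Fin (2 * n)) (Fin (2 * n)) R)
    (a : Fin (2 * n) → Fin (2 * n) → R) :
    pfaffian n (fun i j => ∑ k, ∑ l, M i k * M j l * a k l) = M.det * pfaffian n a := by
  unfold pfaffian
  rw [mul_smul_comm]
  congr 1
  have expand : ∀ p : Equiv.Perm (Fin (2 * n)),
      ∏ i : Fin n, ∑ k, ∑ l, M (p ⟨2 * i, by omega⟩) k * M (p ⟨2 * i + 1, by omega⟩) l * a k l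
        = ∑ φ : Fin (2 * n) → Fin (2 * n), (∏ j, M (p j) (φ j)) *
            ∏ i : Fin n, a (φ ⟨2 * i, by omega⟩) (φ ⟨2 * i + 1, by omega⟩) := by
    intro p
    -- a map on `Fin (2 * n)` is the same as a family of `n` pairs
    let e : (Fin (2 * n) → Fin (2 * n)) ≃ (Fin n → Fin (2 * n) × Fin (2 * n)) :=
      { toFun := fun φ i => (φ ⟨2 * i, by omega⟩, φ ⟨2 * i + 1, by omega⟩)
        invFun := fun ψ j =>
          if (j : ℕ) % 2 = 0 then (ψ ⟨j / 2, by omega⟩).1 else (ψ ⟨j / 2, by omega⟩).2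
        left_inv := by
          intro φ
          ext j : 1
          dsimp only
          split_ifs with h
          · congr 1; ext; dsimp only; omega
          · congr 1; ext; dsimp only; omega
        right_inv := by
          intro ψ
          ext i : 1
          have h1 : (2 * (i : ℕ)) / 2 = i := by omega
          have h2 : (2 * (i : ℕ) + 1) / 2 = i := by omega
          have h3 : (2 * (i : ℕ) + 1) % 2 = 1 := by omega
          simp [h1, h2, h3] }
    simp_rw [← Fintype.sum_prod_type']
    rw [Finset.prod_univ_sum, Fintype.piFinset_univ, ← e.sum_comp]
    refine Finset.sum_congr rfl fun φ _ => ?_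
    rw [prod_pairs n fun j => M (p j) (φ j), ← Finset.prod_mul_distrib]
    rfl
  simp_rw [expand, Finset.mul_sum]
  rw [Finset.sum_comm]
  have inner : ∀ φ : Fin (2 * n) → Fin (2 * n),
      ∑ p : Equiv.Perm (Fin (2 * n)), ((Equiv.Perm.sign p : ℤ) : R) *
        ((∏ j, M (p j) (φ j)) * ∏ i : Fin n, a (φ ⟨2 * i, by omega⟩) (φ ⟨2 * i + 1, by omega⟩))
      = (M.submatrix id φ).det *
          ∏ i : Fin n, a (φ ⟨2 * i, by omega⟩) (φ ⟨2 * i + 1, by omega⟩) := by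
    intro φ
    rw [Matrix.det_apply', Finset.sum_mul]
    simp only [Matrix.submatrix_apply, id, mul_assoc]
  simp_rw [inner]
  symm
  refine Finset.sum_of_injOn (fun p : Equiv.Perm (Fin (2 * n)) => (p : Fin (2 * n) → Fin (2 * n)))
    (fun p _ q _ h => Equiv.coe_fn_injective h)
    (fun _ _ => Finset.mem_coe.2 (Finset.mem_univ _)) ?_ ?_
  · intro φ _ hφ
    have hφ' : ¬ Function.Injective φ := fun hinj => hφ
      ⟨Equiv.ofBijective φ (Finite.injective_iff_bijective.1 hinj), by simp, rfl⟩
    simp only [Function.Injective, not_forall] at hφ'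
    obtain ⟨i, j, hij, hne⟩ := hφ'
    rw [Matrix.det_zero_of_column_eq hne (fun k => by simp [hij]), zero_mul]
  · intro p _
    rw [Matrix.det_permute']
    ring

/-- The summand of a permutation in the Pfaffian, without the factor `1 / (n! 2 ^ n)`. -/
def pfaffianTerm (n : ℕ) (a : Fin (2 * n) → Fin (2 * n) → R) (p : Equiv.Perm (Fin (2 * n))) : R :=
  ((Equiv.Perm.sign p : ℤ) : R) *
    ∏ i : Fin n, a (p ⟨2 * i, by omega⟩) (p ⟨2 * i + 1, by omega⟩)

theorem pfaffianTerm_mul_flip {n : ℕ} {a : Fin (2 * n) → Fin (2 * n) → R}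
    (ha : ∀ i j, a i j = -a j i) (p : Equiv.Perm (Fin (2 * n))) (i : Fin n) :
    pfaffianTerm n a (p * Equiv.swap ⟨2 * i, by omega⟩ ⟨2 * i + 1, by omega⟩)
      = pfaffianTerm n a p := by
  unfold pfaffianTerm
  rw [← Finset.mul_prod_erase _ _ (Finset.mem_univ i),
    ← Finset.mul_prod_erase _ (fun i : Fin n => a (p ⟨2 * i, by omega⟩) (p ⟨2 * i + 1, by omega⟩))
      (Finset.mem_univ i),
    Finset.prod_congr rfl (g := fun i : Fin n => a (p ⟨2 * i, by omega⟩) (p ⟨2 * i + 1, by omega⟩))]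
  · rw [Equiv.Perm.sign_mul, Equiv.Perm.sign_swap (by simp)]
    simp only [Equiv.Perm.mul_apply, Equiv.swap_apply_left, Equiv.swap_apply_right]
    rw [ha (p ⟨2 * i + 1, _⟩)]
    push_cast
    ring
  · intro j hj
    have hj' : (j : ℕ) ≠ i := fun h => (Finset.mem_erase.1 hj).1 (Fin.ext h)
    simp only [Equiv.Perm.mul_apply]
    rw [Equiv.swap_apply_of_ne_of_ne, Equiv.swap_apply_of_ne_of_ne] <;>
      (simp only [ne_eq, Fin.mk.injEq]; omega)

theorem pfaffianTerm_mul_swapPairs {n : ℕ} (a : Fin (2 * n) → Fin (2 * n) → R)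
    (p : Equiv.Perm (Fin (2 * n))) (i j : Fin n) :
    pfaffianTerm n a (p * (Equiv.swap ⟨2 * i, by omega⟩ ⟨2 * j, by omega⟩ *
        Equiv.swap ⟨2 * i + 1, by omega⟩ ⟨2 * j + 1, by omega⟩)) = pfaffianTerm n a p := by
  rcases eq_or_ne i j with rfl | hij
  · simp only [Equiv.swap_self]
    exact congrArg (pfaffianTerm n a) (mul_one p)
  have hij' : (i : ℕ) ≠ j := fun h => hij (Fin.ext h)
  unfold pfaffianTerm
  congr 1
  · rw [Equiv.Perm.sign_mul, Equiv.Perm.sign_mul, Equiv.Perm.sign_swap (by simp; omega),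
      Equiv.Perm.sign_swap (by simp; omega)]
    simp
  · rw [← Equiv.prod_comp (Equiv.swap i j)]
    refine Finset.prod_congr rfl fun k _ => ?_
    simp only [Equiv.Perm.mul_apply]
    have e1 : ∀ x : Fin n, Equiv.swap (⟨2 * i, by omega⟩ : Fin (2 * n)) ⟨2 * j, by omega⟩
        (Equiv.swap ⟨2 * i + 1, by omega⟩ ⟨2 * j + 1, by omega⟩ ⟨2 * x, by omega⟩)
        = ⟨2 * (Equiv.swap i j x : Fin n), by omega⟩ := by
      intro x
      simp only [Equiv.swap_apply_def, Fin.ext_iff]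
      split_ifs <;> (try simp_all) <;> omega
    have e2 : ∀ x : Fin n, Equiv.swap (⟨2 * i, by omega⟩ : Fin (2 * n)) ⟨2 * j, by omega⟩
        (Equiv.swap ⟨2 * i + 1, by omega⟩ ⟨2 * j + 1, by omega⟩ ⟨2 * x + 1, by omega⟩)
        = ⟨2 * (Equiv.swap i j x : Fin n) + 1, by omega⟩ := by
      intro x
      simp only [Equiv.swap_apply_def, Fin.ext_iff]
      split_ifs <;> (try simp_all) <;> omega
    simp only [e1, e2, Equiv.swap_apply_self]

/-- The permutations that send a given position to `m` contribute the same to the Pfaffian for every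
position, because the terms do not change when a pair is flipped or two pairs are exchanged. -/
theorem sum_pfaffianTerm_fiber {n : ℕ} {a : Fin (2 * n) → Fin (2 * n) → R}
    (ha : ∀ i j, a i j = -a j i) (m : Fin (2 * n)) (i : Fin n) (k : Fin (2 * n)) :
    ∑ p with (fun p : Equiv.Perm (Fin (2 * n)) => p⁻¹ m) p = k, pfaffianTerm n a p
      = ∑ p with (fun p : Equiv.Perm (Fin (2 * n)) => p⁻¹ m) p = ⟨2 * i, by omega⟩,
          pfaffianTerm n a p := by
  have shift : ∀ (h : Equiv.Perm (Fin (2 * n))) (k l : Fin (2 * n)), h l = k →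
      (∀ p, pfaffianTerm n a (p * h) = pfaffianTerm n a p) →
      ∑ p with (fun p : Equiv.Perm (Fin (2 * n)) => p⁻¹ m) p = k, pfaffianTerm n a p
      = ∑ p with (fun p : Equiv.Perm (Fin (2 * n)) => p⁻¹ m) p = l, pfaffianTerm n a p := by
    intro h k l hl hp
    refine Finset.sum_equiv (Equiv.mulRight h) (fun p => ?_) (fun p _ => by simp [hp])
    simp [← hl, Equiv.symm_apply_eq]
  have even : ∀ j : Fin n,
      ∑ p with (fun p : Equiv.Perm (Fin (2 * n)) => p⁻¹ m) p = ⟨2 * j, by omega⟩,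
          pfaffianTerm n a p
      = ∑ p with (fun p : Equiv.Perm (Fin (2 * n)) => p⁻¹ m) p = ⟨2 * i, by omega⟩,
          pfaffianTerm n a p := by
    intro j
    refine shift _ _ _ ?_ fun p => pfaffianTerm_mul_swapPairs a p j i
    rw [Equiv.Perm.mul_apply,
      Equiv.swap_apply_of_ne_of_ne (x := (⟨2 * i, by omega⟩ : Fin (2 * n))),
      Equiv.swap_apply_right] <;>
      (simp only [ne_eq, Fin.mk.injEq]; omega)
  rcases Nat.even_or_odd' (k : ℕ) with ⟨j, hj | hj⟩
  · rw [← even ⟨j, by omega⟩]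
    simp only [← hj, Fin.eta]
  · rw [← even ⟨j, by omega⟩]
    simp only [show k = ⟨2 * j + 1, by omega⟩ from Fin.ext hj]
    refine shift _ _ _ ?_ fun p => pfaffianTerm_mul_flip ha p ⟨j, by omega⟩
    rw [Equiv.swap_apply_left]

/-- Expansion of a Pfaffian along its row `2 * n`, when the only nonzero entry of this row is the
last one. By symmetry it suffices to count the permutations that fix `2 * n`, and the terms of those
that do not fix `2 * n + 1` vanish. -/
theorem pfaffian_succ [Algebra ℚ R] {n : ℕ} {a : Fin (2 * (n + 1)) → Fin (2 * (n + 1)) → R}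
    (ha : ∀ i j, a i j = -a j i)
    (h0 : ∀ i : Fin (2 * (n + 1)), (i : ℕ) < 2 * n → a i ⟨2 * n, by omega⟩ = 0) :
    pfaffian (n + 1) a = a ⟨2 * n, by omega⟩ ⟨2 * n + 1, by omega⟩ *
      pfaffian n fun i j => a ⟨i, by omega⟩ ⟨j, by omega⟩ := by
  set m : Fin (2 * (n + 1)) := ⟨2 * n, by omega⟩ with hm
  set l : Fin (2 * (n + 1)) := ⟨2 * n + 1, by omega⟩ with hl
  have key : ∑ p with (fun p : Equiv.Perm (Fin (2 * (n + 1))) => p⁻¹ m) p = m,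
      pfaffianTerm (n + 1) a p
      = a m l * ∑ p, pfaffianTerm n (fun i j => a ⟨i, by omega⟩ ⟨j, by omega⟩) p := by
    let e : Fin (2 * n) ≃ {x : Fin (2 * (n + 1)) // (x : ℕ) < 2 * n} :=
      { toFun := fun i => ⟨⟨i, by omega⟩, i.2⟩
        invFun := fun x => ⟨x.1, x.2⟩
        left_inv := fun _ => rfl
        right_inv := fun _ => rfl }
    have hlt : ∀ (p : Equiv.Perm (Fin (2 * n))) (x : ℕ) (hx : x < 2 * n),
        p.extendDomain e ⟨x, by omega⟩ = ⟨p ⟨x, hx⟩, by omega⟩ := fun p x hx =>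
      p.extendDomain_apply_image e ⟨x, hx⟩
    have hge : ∀ (p : Equiv.Perm (Fin (2 * n))) (x : Fin (2 * (n + 1))), ¬ (x : ℕ) < 2 * n →
        p.extendDomain e x = x := fun p x hx => p.extendDomain_apply_not_subtype e hx
    rw [Finset.mul_sum]
    symm
    refine Finset.sum_of_injOn (fun p => p.extendDomain e)
      (fun p _ q _ h => Equiv.Perm.extendDomainHom_injective e h) ?_ ?_ ?_
    · intro p _
      simp only [Finset.coe_filter, Finset.mem_univ, true_and, Set.mem_ofPred_eq]
      rw [Equiv.Perm.inv_eq_iff_eq, hge p m (by simp [hm])]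
    · intro p hp hp'
      simp only [Finset.mem_filter, Finset.mem_univ, true_and, Equiv.Perm.inv_eq_iff_eq] at hp
      have hpl : p l ≠ m := fun h => by
        have := p.injective (h.trans hp)
        simp [hm, hl] at this
      -- a permutation fixing `2n` and `2n + 1` comes from one of `Fin (2 * n)`
      have hpl' : p l ≠ l := by
        intro hpl'
        refine hp' ?_
        have hfix : ∀ x : Fin (2 * (n + 1)), ¬ (x : ℕ) < 2 * n → p x = x := by
          intro x hx
          obtain h | h : x = m ∨ x = l := by
            simp only [Fin.ext_iff, hm, hl]; omega
          · rw [h, ← hp]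
          · rw [h, hpl']
        have hst : ∀ x : Fin (2 * (n + 1)), (p x : ℕ) < 2 * n ↔ (x : ℕ) < 2 * n := by
          intro x
          constructor
          · intro h
            by_contra hx
            exact hx (hfix x hx ▸ h)
          · intro h
            by_contra hx
            have := p.injective (hfix _ hx)
            exact hx (this.symm ▸ h)
        refine ⟨e.symm.permCongr (p.subtypePerm hst), by simp, ?_⟩
        ext x : 1
        by_cases hx : (x : ℕ) < 2 * n
        · exact (hlt _ x hx).trans (Fin.ext rfl)
        · exact (hge _ x hx).trans (hfix x hx).symm
      have hlt' : (p l : ℕ) < 2 * n := by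
        have h1 : (p l : ℕ) ≠ 2 * n := fun h => hpl (Fin.ext h)
        have h2 : (p l : ℕ) ≠ 2 * n + 1 := fun h => hpl' (Fin.ext h)
        have := (p l).2
        omega
      unfold pfaffianTerm
      rw [Fin.prod_univ_castSucc]
      have : a (p ⟨2 * (Fin.last n : Fin (n + 1)), by simp⟩)
          (p ⟨2 * (Fin.last n : Fin (n + 1)) + 1, by simp; omega⟩) = 0 := by
        change a (p m) (p l) = 0
        rw [← hp, ha, h0 _ hlt', neg_zero]
      rw [this]
      simp
    · intro p _
      unfold pfaffianTerm
      rw [Equiv.Perm.sign_extendDomain, Fin.prod_univ_castSucc]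
      have h1 : a (p.extendDomain e ⟨2 * (Fin.last n : Fin (n + 1)), by simp⟩)
          (p.extendDomain e ⟨2 * (Fin.last n : Fin (n + 1)) + 1, by simp; omega⟩) = a m l := by
        change a (p.extendDomain e m) (p.extendDomain e l) = a m l
        rw [hge p m (by simp [hm]), hge p l (by simp [hl])]
      rw [h1]
      have h2 : ∀ i : Fin n,
          a (p.extendDomain e ⟨2 * (i.castSucc : Fin (n + 1)), by simp⟩)
            (p.extendDomain e ⟨2 * (i.castSucc : Fin (n + 1)) + 1, by simp; omega⟩)
          = a ⟨p ⟨2 * i, by omega⟩, by omega⟩ ⟨p ⟨2 * i + 1, by omega⟩, by omega⟩ := by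
        intro i
        rw [← hlt p (2 * i) (by omega), ← hlt p (2 * i + 1) (by omega)]
        rfl
      simp_rw [h2]
      ring
  have total : ∑ p, pfaffianTerm (n + 1) a p = (2 * (n + 1)) *
      (a m l * ∑ p, pfaffianTerm n (fun i j => a ⟨i, by omega⟩ ⟨j, by omega⟩) p) := by
    rw [← Finset.sum_fiberwise Finset.univ (fun p : Equiv.Perm (Fin (2 * (n + 1))) => p⁻¹ m),
      Finset.sum_congr rfl (fun k _ => sum_pfaffianTerm_fiber ha m (Fin.last n) k)]
    rw [Finset.sum_const, Finset.card_univ, Fintype.card_fin, ← key, nsmul_eq_mul]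
    push_cast
    rfl
  change (1 / (((n + 1).factorial : ℚ) * 2 ^ (n + 1))) • ∑ p, pfaffianTerm (n + 1) a p
    = a m l * ((1 / ((n.factorial : ℚ) * 2 ^ n)) •
      ∑ p, pfaffianTerm n (fun i j => a ⟨i, by omega⟩ ⟨j, by omega⟩) p)
  rw [total, mul_smul_comm]
  have h2 : (2 * ((n : R) + 1)) = algebraMap ℚ R (2 * (n + 1)) := by simp [map_ofNat]
  rw [h2, ← Algebra.smul_def, smul_smul]
  congr 1
  rw [Nat.factorial_succ]
  have := Nat.factorial_ne_zero n
  push_cast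
  field_simp
  ring

theorem pfaffian_zero [Algebra ℚ R] (a : Fin (2 * 0) → Fin (2 * 0) → R) : pfaffian 0 a = 1 := by
  have : Subsingleton (Equiv.Perm (Fin (2 * 0))) :=
    inferInstanceAs (Subsingleton (Equiv.Perm (Fin 0)))
  simp [pfaffian]

end Pfaffian

/-! ### Degrees of polynomials -/

section Degree

variable {K : Type*} [Field K]

theorem degree_sub_coeff_smul_lt {p g : K[X]} {k : ℕ} (hp : p.Monic) (hd : p.natDegree = k)
    (hg : g.degree < (k + 1 : ℕ)) : (g - g.coeff k • p).degree < k := by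
  rw [degree_lt_iff_coeff_zero] at hg ⊢
  intro m hm
  rcases hm.eq_or_lt with rfl | hlt
  · have : p.coeff k = 1 := by rwa [Monic, leadingCoeff, hd] at hp
    simp [this]
  · have : p.coeff m = 0 := coeff_eq_zero_of_natDegree_lt (by omega)
    rw [coeff_sub, coeff_smul, hg m (by omega), this]
    simp

/-- A linear functional vanishes on polynomials of degree less than `k` if it vanishes on the first
`k` members of a monic sequence with one polynomial of each degree. -/
theorem linearMap_eq_zero_of_monic {p : ℕ → K[X]} (hm : ∀ n, (p n).Monic)
    (hd : ∀ n, (p n).natDegree = n) (φ : K[X] →ₗ[K] K) (k : ℕ) (h : ∀ i < k, φ (p i) = 0)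
    {g : K[X]} (hg : g.degree < k) : φ g = 0 := by
  induction k generalizing g with
  | zero =>
    have : g = 0 := by
      rw [← Polynomial.degree_eq_bot]
      simpa using hg
    simp [this]
  | succ k ih =>
    have h2 := ih (fun i hi => h i (by omega)) (degree_sub_coeff_smul_lt (hm k) (hd k) hg)
    rw [map_sub, map_smul, h k (by omega), smul_zero, sub_zero] at h2
    exact h2

theorem det_coeff_matrix {R : Type*} [CommRing R] (N : ℕ) {f : ℕ → R[X]}
    (hm : ∀ n, (f n).Monic) (hd : ∀ n, (f n).natDegree = n) :
    (Matrix.of fun i j : Fin N => (f i).coeff j).det = 1 := by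
  rw [← Matrix.det_transpose]
  exact Matrix.det_matrixOfPolynomials (fun i : Fin N => f i) (fun i => hd i) (fun i => hm i)

theorem degree_X_sub_C_mul_lt {f : K[X]} {c : K} {n : ℕ} (hf : f.degree < (n : ℕ)) :
    ((X - C c) * f).degree < ((n + 1 : ℕ) : WithBot ℕ) := by
  rcases eq_or_ne f 0 with rfl | hne
  · simp
  · rw [degree_mul, degree_X_sub_C, degree_eq_natDegree hne] at *
    norm_cast at *
    omega

theorem degree_lt_of_X_sub_C_mul {f : K[X]} {c : K} {n : ℕ}
    (hf : ((X - C c) * f).degree < ((n + 1 : ℕ) : WithBot ℕ)) : f.degree < (n : ℕ) := by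
  rcases eq_or_ne f 0 with rfl | hne
  · simp
  · rw [degree_mul, degree_X_sub_C, degree_eq_natDegree hne] at *
    norm_cast at *
    omega

/-- A polynomial of degree less than `N + 2` vanishing at `mu` and `lam` is
`(z - mu) (z - lam) f` with `f` of degree less than `N`. -/
theorem exists_eq_mul_mul {lam mu : K} (hne : lam ≠ mu) {E : K[X]} {N : ℕ}
    (hE : E ∈ degreeLT K (N + 2)) (hmu : E.eval mu = 0) (hlam : E.eval lam = 0) :
    ∃ f : K[X], f.degree < (N : ℕ) ∧ E = (X - C mu) * ((X - C lam) * f) := by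
  obtain ⟨g, rfl⟩ := dvd_iff_isRoot.2 hmu
  have hg : g.eval lam = 0 := by
    simpa [sub_ne_zero.2 hne] using hlam
  obtain ⟨f, rfl⟩ := dvd_iff_isRoot.2 hg
  rw [mem_degreeLT] at hE
  exact ⟨f, degree_lt_of_X_sub_C_mul (degree_lt_of_X_sub_C_mul hE), rfl⟩

theorem mem_degreeLT_X_sub_C_mul {f : K[X]} {N : ℕ} (c : K) (hf : f ∈ degreeLT K N) :
    (X - C c) * f ∈ degreeLT K (N + 1) := by
  rw [mem_degreeLT] at *
  exact degree_X_sub_C_mul_lt hf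

theorem sub_mem_degreeLT {f g : K[X]} {N : ℕ} (hf : f.Monic) (hg : g.Monic)
    (hfN : f.natDegree = N) (hgN : g.natDegree = N) : f - g ∈ degreeLT K N := by
  rw [mem_degreeLT]
  have h := degree_sub_lt_left (p := f) (q := g)
    (by rw [degree_eq_natDegree hf.ne_zero, degree_eq_natDegree hg.ne_zero, hfN, hgN]) hf.ne_zero
    (by rw [hf.leadingCoeff, hg.leadingCoeff])
  rwa [degree_eq_natDegree hf.ne_zero, hfN] at h

theorem monic_X_sub_C_mul {f : K[X]} (c : K) (hf : f.Monic) : ((X - C c) * f).Monic :=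
  (monic_X_sub_C c).mul hf

theorem natDegree_X_sub_C_mul {f : K[X]} (c : K) (hf : f.Monic) :
    ((X - C c) * f).natDegree = f.natDegree + 1 := by
  rw [(monic_X_sub_C c).natDegree_mul hf, natDegree_X_sub_C, add_comm]

end Degree

/-! ### Skew orthogonal polynomials and their Pfaffian formula -/

section SkewOrthogonal

variable {K : Type*} [Field K]

namespace IsMonicSOP

variable {b : K[X] →ₗ[K] K[X] →ₗ[K] K} {q : ℕ → K[X]}

theorem degree_eq (h : IsMonicSOP b q) (n : ℕ) : (q n).degree = n := by
  rw [degree_eq_natDegree (h.monic n).ne_zero, h.natDegree]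

theorem mem_degreeLT (h : IsMonicSOP b q) {m N : ℕ} (hmN : m < N) : q m ∈ degreeLT K N := by
  rw [Polynomial.mem_degreeLT, h.degree_eq]
  exact_mod_cast hmN

theorem norm_ne_zero (h : IsMonicSOP b q) (n : ℕ) : b (q (2 * n)) (q (2 * n + 1)) ≠ 0 := by
  obtain ⟨r, hr, hb⟩ := h.even_odd
  rw [hb, if_pos rfl]
  exact hr n

theorem even_odd_ne (h : IsMonicSOP b q) {m n : ℕ} (hmn : m ≠ n) :
    b (q (2 * m)) (q (2 * n + 1)) = 0 := by
  obtain ⟨r, hr, hb⟩ := h.even_odd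
  rw [hb, if_neg hmn]

theorem pair_even_of_lt (h : IsMonicSOP b q) (n : ℕ) {g : K[X]}
    (hg : g.degree < (2 * n + 1 : ℕ)) : b (q (2 * n)) g = 0 := by
  refine linearMap_eq_zero_of_monic h.monic h.natDegree (b (q (2 * n))) _ (fun i hi => ?_) hg
  rcases Nat.even_or_odd' i with ⟨j, rfl | rfl⟩
  · exact h.even_even _ _
  · exact h.even_odd_ne (by omega)

/-- Up to the normalization `r_n`, pairing with `q_{2n}` extracts the coefficient of degree
`2n + 1`. -/
theorem pair_even (h : IsMonicSOP b q) (n : ℕ) {g : K[X]}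
    (hg : g.degree < (2 * n + 2 : ℕ)) :
    b (q (2 * n)) g = g.coeff (2 * n + 1) * b (q (2 * n)) (q (2 * n + 1)) := by
  have h2 := h.pair_even_of_lt n (degree_sub_coeff_smul_lt (h.monic _) (h.natDegree _) hg)
  rwa [map_sub, map_smul, sub_eq_zero, smul_eq_mul] at h2

theorem pair_odd_of_lt (h : IsMonicSOP b q) (n : ℕ) {g : K[X]}
    (hg : g.degree < (2 * n : ℕ)) : b g (q (2 * n + 1)) = 0 := by
  refine linearMap_eq_zero_of_monic h.monic h.natDegree (b.flip (q (2 * n + 1))) _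
    (fun i hi => ?_) hg
  rcases Nat.even_or_odd' i with ⟨j, rfl | rfl⟩
  · exact h.even_odd_ne (by omega)
  · exact h.odd_odd _ _

/-- The form is nondegenerate on the polynomials of degree less than `2n`. -/
theorem eq_zero_of_forall_pair (hs : IsSkew b) (h : IsMonicSOP b q) (n : ℕ) {f : K[X]}
    (hf : f.degree < (2 * n : ℕ))
    (h0 : ∀ g : K[X], g.degree < (2 * n : ℕ) → b f g = 0) : f = 0 := by
  by_contra hne
  have hlt : f.natDegree < 2 * n := (natDegree_lt_iff_degree_lt hne).2 hf
  have hlc : f.coeff f.natDegree ≠ 0 := leadingCoeff_ne_zero.2 hne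
  have hdeg : f.degree = f.natDegree := degree_eq_natDegree hne
  rcases Nat.even_or_odd' f.natDegree with ⟨j, hj | hj⟩
  · have h2 := h.pair_odd_of_lt j (degree_sub_coeff_smul_lt (h.monic _) (h.natDegree _)
      (g := f) (by rw [hdeg, hj]; exact_mod_cast (by omega)))
    rw [map_sub, map_smul, LinearMap.sub_apply, LinearMap.smul_apply, h0 _ (by
      rw [h.degree_eq]; exact_mod_cast (by omega)), zero_sub, neg_eq_zero, smul_eq_mul,
      mul_eq_zero] at h2
    exact h2.elim (hj ▸ hlc) (h.norm_ne_zero j)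
  · have h2 := h.pair_even j (g := f) (by rw [hdeg, hj]; exact_mod_cast (by omega))
    rw [hs, h0 _ (by rw [h.degree_eq]; exact_mod_cast (by omega)), neg_zero, eq_comm,
      mul_eq_zero] at h2
    exact h2.elim (hj ▸ hlc) (h.norm_ne_zero j)

/-- The radical of the form on the polynomials of degree at most `2n` is spanned by `q_{2n}`. -/
theorem eq_smul_of_forall_pair (hs : IsSkew b) (h : IsMonicSOP b q) (n : ℕ) {f : K[X]}
    (hf : f.degree < (2 * n + 1 : ℕ))
    (h0 : ∀ g : K[X], g.degree < (2 * n : ℕ) → b f g = 0) :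
    f = f.coeff (2 * n) • q (2 * n) := by
  rw [← sub_eq_zero]
  refine h.eq_zero_of_forall_pair hs n ?_ fun g hg => ?_
  · exact degree_sub_coeff_smul_lt (h.monic _) (h.natDegree _) hf
  · rw [map_sub, map_smul, LinearMap.sub_apply, LinearMap.smul_apply, h0 g hg,
      h.pair_even_of_lt n (hg.trans (by exact_mod_cast (by omega)))]
    simp

variable [CharZero K]

/-- `τ_n` is the Pfaffian of the Gram matrix of `q_0, …, q_{2n-1}`. -/
theorem pfTau_eq (h : IsMonicSOP b q) (n : ℕ) :
    pfTau b n = pfaffian n fun i j => b (q i) (q j) := by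
  have hdet := det_coeff_matrix (2 * n) h.monic h.natDegree
  set M := Matrix.of fun i j : Fin (2 * n) => (q i).coeff j with hM
  have conj := pfaffian_conj n M fun i j : Fin (2 * n) => b (X ^ (i : ℕ)) (X ^ (j : ℕ))
  rw [hdet, one_mul] at conj
  rw [pfTau, ← conj]
  congr 1
  ext i j
  have expand : ∀ i : Fin (2 * n), q i = ∑ k : Fin (2 * n), (q i).coeff k • X ^ (k : ℕ) := by
    intro i
    conv_lhs => rw [(q i).as_sum_range' (2 * n) (by rw [h.natDegree]; exact i.2)]
    rw [Finset.sum_range]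
    simp [← C_mul_X_pow_eq_monomial, smul_eq_C_mul]
  conv_rhs => rw [expand i, expand j]
  simp only [map_sum, map_smul, LinearMap.sum_apply, LinearMap.smul_apply, hM,
    Matrix.of_apply, smul_eq_mul, Finset.mul_sum, mul_assoc]
  rw [Finset.sum_comm]
  refine Finset.sum_congr rfl fun k _ => Finset.sum_congr rfl fun l _ => ?_
  ring

theorem pfTau_zero (b : K[X] →ₗ[K] K[X] →ₗ[K] K) : pfTau b 0 = 1 := pfaffian_zero _

theorem pfTau_succ (hs : IsSkew b) (h : IsMonicSOP b q) (n : ℕ) :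
    pfTau b (n + 1) = b (q (2 * n)) (q (2 * n + 1)) * pfTau b n := by
  rw [h.pfTau_eq, h.pfTau_eq]
  refine pfaffian_succ (fun i j => hs _ _) fun i hi => ?_
  rw [hs, h.pair_even_of_lt n, neg_zero]
  rw [h.degree_eq]
  exact_mod_cast (by omega)

theorem pfTau_ne_zero (hs : IsSkew b) (h : IsMonicSOP b q) (n : ℕ) : pfTau b n ≠ 0 := by
  induction n with
  | zero => rw [pfTau_zero]; exact one_ne_zero
  | succ n ih =>
    rw [h.pfTau_succ hs]
    exact mul_ne_zero (h.norm_ne_zero n) ih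

/-- The array bordering the Gram matrix of `f 0, …, f (2 * n)` by these polynomials themselves;
for `f i = X ^ i` its Pfaffian is `τ̂_n`. -/
noncomputable def borderedGram (b : K[X] →ₗ[K] K[X] →ₗ[K] K) (f : ℕ → K[X]) (n : ℕ)
    (i j : Fin (2 * (n + 1))) : K[X] :=
  if (i : ℕ) ≤ 2 * n then
    if (j : ℕ) ≤ 2 * n then C (b (f i) (f j)) else f i
  else
    if (j : ℕ) ≤ 2 * n then -f j else 0

theorem pfTauHat_eq_pfaffian (h : IsMonicSOP b q) (n : ℕ) :
    pfTauHat b n = pfaffian (n + 1) (borderedGram b q n) := by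
  -- the change of basis fixes the index `z`
  set p : ℕ → K[X] := fun i => if i ≤ 2 * n then q i else X ^ i with hp
  have hpd : ∀ i, (p i).natDegree = i := by
    intro i
    simp only [hp]
    split_ifs
    · exact h.natDegree i
    · exact natDegree_X_pow i
  have hpm : ∀ i, (p i).Monic := by
    intro i
    simp only [hp]
    split_ifs
    · exact h.monic i
    · exact monic_X_pow i
  obtain ⟨M, hM, hdet⟩ : ∃ M : Matrix (Fin (2 * (n + 1))) (Fin (2 * (n + 1))) K[X],
      (∀ i j, M i j = C ((p i).coeff j)) ∧ M.det = 1 := by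
    have hdet := det_coeff_matrix (2 * (n + 1)) hpm hpd
    refine ⟨(Matrix.of fun i j : Fin (2 * (n + 1)) => (p i).coeff j).map C, fun i j => rfl, ?_⟩
    rw [← RingHom.mapMatrix_apply, ← RingHom.map_det, hdet, map_one]
  have conj := pfaffian_conj (n + 1) M (borderedGram b (fun i => X ^ i) n)
  rw [hdet, one_mul] at conj
  have hdef : pfTauHat b n = pfaffian (n + 1) (borderedGram b (fun i => X ^ i) n) := rfl
  rw [hdef, ← conj]
  congr 1
  have split : ∀ f : Fin (2 * (n + 1)) → K[X],
      ∑ k, f k = ∑ k : Fin (2 * n + 1), f k.castSucc + f (Fin.last (2 * n + 1)) := fun f =>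
    Fin.sum_univ_castSucc (n := 2 * n + 1) f
  have expand : ∀ i : ℕ, i ≤ 2 * n →
      q i = ∑ k : Fin (2 * n + 1), (q i).coeff k • X ^ (k : ℕ) := by
    intro i hi
    conv_lhs => rw [(q i).as_sum_range' (2 * n + 1) (by rw [h.natDegree]; omega)]
    rw [Finset.sum_range]
    simp [← C_mul_X_pow_eq_monomial, smul_eq_C_mul]
  have hMlow : ∀ i : Fin (2 * (n + 1)), (i : ℕ) ≤ 2 * n → ∀ k : Fin (2 * n + 1),
      M i k.castSucc = C ((q i).coeff k) := by
    intro i hi k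
    simp [hM, hp, hi]
  have hMlast : ∀ i : Fin (2 * (n + 1)), (i : ℕ) ≤ 2 * n → M i (Fin.last (2 * n + 1)) = 0 := by
    intro i hi
    have : (q i).coeff (2 * n + 1) = 0 :=
      coeff_eq_zero_of_natDegree_lt (by rw [h.natDegree]; omega)
    simp [hM, hp, hi, this]
  have hMz : ∀ i : Fin (2 * (n + 1)), ¬ (i : ℕ) ≤ 2 * n → ∀ k : Fin (2 * n + 1),
      M i k.castSucc = 0 := by
    intro i hi k
    have : (k : ℕ) ≠ i := by omega
    simp [hM, hp, hi, coeff_X_pow, this]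
  have hMzz : ∀ i : Fin (2 * (n + 1)), ¬ (i : ℕ) ≤ 2 * n → M i (Fin.last (2 * n + 1)) = 1 := by
    intro i hi
    have : (i : ℕ) = 2 * n + 1 := by omega
    simp [hM, hp, this]
  have hlow : ∀ k : Fin (2 * n + 1), (k : ℕ) ≤ 2 * n := fun k => by omega
  have hlast : ¬ 2 * n + 1 ≤ 2 * n := by omega
  ext1 i
  ext1 j
  simp only [split, borderedGram, Fin.val_castSucc, Fin.val_last, hlow, hlast, if_true, if_false]
  by_cases hi : (i : ℕ) ≤ 2 * n <;> by_cases hj : (j : ℕ) ≤ 2 * n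
  · simp only [hi, hj, if_true, hMlow, hMlast, zero_mul, mul_zero, add_zero,
      Finset.sum_const_zero]
    conv_rhs => rw [expand i hi, expand j hj]
    simp only [map_sum, map_smul, LinearMap.sum_apply, LinearMap.smul_apply, smul_eq_mul,
      Finset.mul_sum, map_mul]
    rw [Finset.sum_comm]
    refine Finset.sum_congr rfl fun k _ => Finset.sum_congr rfl fun l _ => ?_
    ring
  · simp only [hi, hj, if_true, if_false, hMlow, hMlast, hMz, hMzz, not_false_eq_true,
      zero_mul, mul_zero, add_zero, zero_add, mul_one, Finset.sum_const_zero]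
    conv_rhs => rw [expand i hi]
    simp only [smul_eq_C_mul]
  · simp only [hi, hj, if_true, if_false, hMlow, hMlast, hMz, hMzz, not_false_eq_true,
      zero_mul, mul_zero, add_zero, zero_add, one_mul, Finset.sum_const_zero]
    conv_rhs => rw [expand j hj]
    simp only [smul_eq_C_mul, Finset.sum_neg_distrib, mul_neg]
  · simp only [hi, hj, if_false, hMz, hMzz, not_false_eq_true, zero_mul, mul_zero, add_zero,
      Finset.sum_const_zero]

/-- In the array bordered by the `q_i`, the row of `q_{2n}` has only its last entry nonzero. -/
theorem pfTauHat_eq (hs : IsSkew b) (h : IsMonicSOP b q) (n : ℕ) :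
    pfTauHat b n = pfTau b n • q (2 * n) := by
  rw [h.pfTauHat_eq_pfaffian, pfaffian_succ, pfTau_eq h]
  · rw [smul_eq_C_mul, pfaffian_map, mul_comm]
    congr 1
    · congr 1
      ext1 i
      ext1 j
      simp only [borderedGram, show (i : ℕ) ≤ 2 * n by omega, show (j : ℕ) ≤ 2 * n by omega,
        if_true]
    · simp [borderedGram]
  · intro i j
    by_cases hi : (i : ℕ) ≤ 2 * n <;> by_cases hj : (j : ℕ) ≤ 2 * n
    · simp only [borderedGram, hi, hj, if_true]
      rw [hs, map_neg]
    all_goals simp [borderedGram, hi, hj]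
  · intro i hi
    simp only [borderedGram, hi.le, le_refl, if_true]
    rw [hs, h.pair_even_of_lt n, neg_zero, map_zero]
    rw [h.degree_eq]
    exact_mod_cast (by omega)

end IsMonicSOP

end SkewOrthogonal

/-! ### Compatibility of the Lax pair -/

section Compatibility

variable {K : Type*} [Field K] {R : Type*} [CommRing R] [Algebra K R] {σ : Type*} [Add σ] [One σ]

/-- The compatibility condition at `n = 0`: the first Lax equation for `q 1`, in which the second
Lax equation expresses `q 1` by `q 0` and the first one reduces the shifts of `q 0`. -/
theorem IsWaveFunction.relation_zero {lam mu : K} {z : R} {A B C D : ℕ → σ → σ → K}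
    {q : ℕ → σ → σ → R} (hq : IsWaveFunction lam mu z A B C D q) (s t : σ) :
    (- A 1 s t + B 1 s t - B 0 (s + 1) (t + 1)
        - (C 0 s (t + 1) - C 0 (s + 1) t + D 0 (s + 1) t - D 0 s (t + 1))) •
          (shiftBy z mu * shiftBy z lam * q 0 (s + 1) (t + 1))
      + (B 0 s (t + 1) * C 0 s (t + 1) - B 1 s t * C 0 s t) • (shiftBy z lam * q 0 s (t + 1))
      + (B 1 s t * D 0 s t - B 0 (s + 1) t * D 0 (s + 1) t) • (shiftBy z mu * q 0 (s + 1) t)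
      = 0 := by
  have a1 := hq.first 1 s t
  have a2 := hq.first 0 (s + 1) (t + 1)
  have a3 := hq.first 0 s (t + 1)
  have a4 := hq.first 0 (s + 1) t
  have b1 := hq.second 0 s t
  have b2 := hq.second 0 s (t + 1)
  have b3 := hq.second 0 (s + 1) t
  simp only [below, Algebra.smul_def, map_sub, map_add, map_mul, map_neg, zero_add, mul_zero,
    zero_sub] at *
  generalize shiftBy z lam = x at *
  generalize shiftBy z mu = y at *
  linear_combination a1 - y * x * a2 + x * algebraMap K R (C 0 s (t + 1)) * a3
    - y * algebraMap K R (D 0 (s + 1) t) * a4 + x * b2 - y * b3 + algebraMap K R (B 1 s t) * b1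

/-- The compatibility condition at `n + 1`. Compared with `n = 0`, the first Lax equation brings in
two shifts of `q n`. -/
theorem IsWaveFunction.relation_succ {lam mu : K} {z : R} {A B C D : ℕ → σ → σ → K}
    {q : ℕ → σ → σ → R} (hq : IsWaveFunction lam mu z A B C D q) (n : ℕ) (s t : σ) :
    (A (n + 1) (s + 1) (t + 1) - A (n + 1 + 1) s t + B (n + 1 + 1) s t
        - B (n + 1) (s + 1) (t + 1)
        - (C (n + 1) s (t + 1) - C (n + 1) (s + 1) t + D (n + 1) (s + 1) t
          - D (n + 1) s (t + 1))) •
          (shiftBy z mu * shiftBy z lam * q (n + 1) (s + 1) (t + 1))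
      + (B (n + 1) s (t + 1) * C (n + 1) s (t + 1) - B (n + 1 + 1) s t * C (n + 1) s t) •
          (shiftBy z lam * q (n + 1) s (t + 1))
      + (B (n + 1 + 1) s t * D (n + 1) s t - B (n + 1) (s + 1) t * D (n + 1) (s + 1) t) •
          (shiftBy z mu * q (n + 1) (s + 1) t)
      + (A (n + 1) (s + 1) (t + 1) * C n (s + 1) (t + 1)
          - A (n + 1) s (t + 1) * C (n + 1) s (t + 1)) •
          (shiftBy z mu * shiftBy z lam ^ 2 * q n (s + 1) (t + 1 + 1))
      + (A (n + 1) (s + 1) t * D (n + 1) (s + 1) t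
          - A (n + 1) (s + 1) (t + 1) * D n (s + 1) (t + 1)) •
          (shiftBy z mu ^ 2 * shiftBy z lam * q n (s + 1 + 1) (t + 1))
      = 0 := by
  have a1 := hq.first (n + 1 + 1) s t
  have a2 := hq.first (n + 1) (s + 1) (t + 1)
  have a3 := hq.first (n + 1) s (t + 1)
  have a4 := hq.first (n + 1) (s + 1) t
  have b1 := hq.second (n + 1) s t
  have b2 := hq.second (n + 1) s (t + 1)
  have b3 := hq.second (n + 1) (s + 1) t
  have b4 := hq.second n (s + 1) (t + 1)
  simp only [below, Algebra.smul_def, map_sub, map_add, map_mul] at *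
  generalize shiftBy z lam = x at *
  generalize shiftBy z mu = y at *
  linear_combination a1 - y * x * a2 + x * algebraMap K R (C (n + 1) s (t + 1)) * a3
    - y * algebraMap K R (D (n + 1) (s + 1) t) * a4 + x * b2 - y * b3
    + algebraMap K R (B (n + 1 + 1) s t) * b1
    - y * x * algebraMap K R (A (n + 1) (s + 1) (t + 1)) * b4

theorem IsWaveFunction.discretePfaffLattice {lam mu : K} {z : R} {A B C D : ℕ → ℤ → ℤ → K}
    {q : ℕ → ℤ → ℤ → R} (hA : ∀ s t, A 0 s t = 0) (hq : IsWaveFunction lam mu z A B C D q)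
    (hg : InGeneralPosition lam mu z q) : DiscretePfaffLattice A B C D := by
  have zero : ∀ s t, _ ∧ _ ∧ _ := fun s t => by
    have h := Fintype.linearIndependent_iff.1 (hg.zero s t) ![_, _, _] (by
      simpa [Fin.sum_univ_succ, ← add_assoc] using hq.relation_zero s t)
    exact ⟨h 0, h 1, h 2⟩
  have succ : ∀ n s t, _ ∧ _ ∧ _ ∧ _ ∧ _ := fun n s t => by
    have h := Fintype.linearIndependent_iff.1 (hg.succ n s t) ![_, _, _, _, _] (by
      simpa [Fin.sum_univ_succ, ← add_assoc] using hq.relation_succ n s t)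
    exact ⟨h 0, h 1, h 2, h 3, h 4⟩
  simp only [Matrix.cons_val, Matrix.cons_val_zero, Matrix.cons_val_one] at zero succ
  refine ⟨hA, ?_, ?_, ?_, ?_, ?_⟩
  · rintro (_ | n) s t
    · rw [hA]
      linear_combination (zero s t).1
    · linear_combination (succ n s t).1
  -- these relations appear at shifted sites only, so that the lattice has to extend to `-∞`
  · intro n s t
    have := (succ n s (t - 1)).2.2.2.1
    rw [sub_add_cancel] at this
    linear_combination this
  · intro n s t
    have := (succ n (s - 1) t).2.2.2.2
    rw [sub_add_cancel] at this
    linear_combination -this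
  · rintro (_ | n) s t
    · linear_combination -(zero s t).2.2
    · linear_combination -(succ n s t).2.2.1
  · rintro (_ | n) s t
    · linear_combination (zero s t).2.1
    · linear_combination (succ n s t).2.1

/-- The wave function built from its values at `n = 0` by solving the second Lax equation for
`q (n + 1)`. -/
def waveExtension (lam mu : K) (z : R) (C D : ℕ → σ → σ → K) (q₀ : σ → σ → R) : ℕ → σ → σ → R
  | 0 => q₀
  | n + 1 => fun s t =>
      shiftBy z mu * shiftBy z lam * waveExtension lam mu z C D q₀ n (s + 1) (t + 1)
        - (shiftBy z lam * (C n s t • waveExtension lam mu z C D q₀ n s (t + 1))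
          - shiftBy z mu * (D n s t • waveExtension lam mu z C D q₀ n (s + 1) t))

theorem DiscretePfaffLattice.isWaveFunction_waveExtension {lam mu : K} {z : R}
    {A B C D : ℕ → σ → σ → K} (h : DiscretePfaffLattice A B C D) {q₀ : σ → σ → R}
    (h0 : ∀ s t, shiftBy z lam * q₀ s (t + 1) - shiftBy z mu * q₀ (s + 1) t = -(B 0 s t • q₀ s t)) :
    IsWaveFunction lam mu z A B C D (waveExtension lam mu z C D q₀) := by
  set q := waveExtension lam mu z C D q₀ with hq
  have b : ∀ n s t, shiftBy z mu * shiftBy z lam * q n (s + 1) (t + 1) - q (n + 1) s t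
      = shiftBy z lam * (C n s t • q n s (t + 1)) - shiftBy z mu * (D n s t • q n (s + 1) t) := by
    intro n s t
    simp only [hq, waveExtension]
    ring
  refine ⟨fun n => ?_, b⟩
  have hq0 : q 0 = q₀ := rfl
  clear_value q
  induction n with
  | zero =>
    intro s t
    simp [below, hq0, h0]
  | succ n ih =>
    intro s t
    have r1 := congrArg (algebraMap K R) (h.additive n s t)
    have r2 := congrArg (algebraMap K R) (h.mulBC n s t)
    have r3 := congrArg (algebraMap K R) (h.mulBD n s t)
    have a2 := ih (s + 1) (t + 1)
    have a3 := ih s (t + 1)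
    have a4 := ih (s + 1) t
    have b1 := b n s t
    have b2 := b n s (t + 1)
    have b3 := b n (s + 1) t
    rcases n with _ | n
    · rw [h.boundary] at r1
      simp only [below, Algebra.smul_def, map_sub, map_add, map_mul, map_neg, zero_add, mul_zero,
        zero_sub] at *
      generalize shiftBy z lam = x at *
      generalize shiftBy z mu = y at *
      linear_combination y * x * q 0 (s + 1) (t + 1) * r1 + x * q 0 s (t + 1) * r2
        - y * q 0 (s + 1) t * r3
        + y * x * a2 - x * algebraMap K R (C 0 s (t + 1)) * a3
        + y * algebraMap K R (D 0 (s + 1) t) * a4 - x * b2 + y * b3 - algebraMap K R (B 1 s t) * b1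
    · have r4 := congrArg (algebraMap K R) (h.mulAC n s (t + 1))
      have r5 := congrArg (algebraMap K R) (h.mulAD n (s + 1) t)
      have b4 := b n (s + 1) (t + 1)
      simp only [below, Algebra.smul_def, map_sub, map_add, map_mul] at *
      generalize shiftBy z lam = x at *
      generalize shiftBy z mu = y at *
      linear_combination y * x * q (n + 1) (s + 1) (t + 1) * r1 + x * q (n + 1) s (t + 1) * r2
        - y * q (n + 1) (s + 1) t * r3
        + y * x ^ 2 * q n (s + 1) (t + 1 + 1) * r4 - y ^ 2 * x * q n (s + 1 + 1) (t + 1) * r5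
        + y * x * a2 - x * algebraMap K R (C (n + 1) s (t + 1)) * a3
        + y * algebraMap K R (D (n + 1) (s + 1) t) * a4 - x * b2 + y * b3
        - algebraMap K R (B (n + 1 + 1) s t) * b1
        + y * x * algebraMap K R (A (n + 1) (s + 1) (t + 1)) * b4

theorem DiscretePfaffLattice.existsUnique_isWaveFunction {lam mu : K} {z : R}
    {A B C D : ℕ → σ → σ → K} (h : DiscretePfaffLattice A B C D) {q₀ : σ → σ → R}
    (h0 : ∀ s t, shiftBy z lam * q₀ s (t + 1) - shiftBy z mu * q₀ (s + 1) t = -(B 0 s t • q₀ s t)) :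
    ∃! q : ℕ → σ → σ → R, q 0 = q₀ ∧ IsWaveFunction lam mu z A B C D q := by
  refine ⟨_, ⟨rfl, h.isWaveFunction_waveExtension h0⟩, ?_⟩
  rintro q ⟨hq0, hq⟩
  funext n
  induction n with
  | zero => exact hq0
  | succ n ih =>
    funext s t
    have := hq.second n s t
    rw [ih] at this
    simp only [waveExtension]
    linear_combination -this

end Compatibility

/-! ### The discrete coupled KP equation -/

section CoupledKP

variable {K : Type*} [Field K] {R : Type*} [CommRing R] [Algebra K R] {σ : Type*} [Add σ] [One σ]

theorem discreteCoupledKP_iff {lam mu : K} (hne : lam ≠ mu) (z : R) {tau : ℕ → σ → σ → K}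
    (tauHat : ℕ → σ → σ → R) (ht : ∀ n s t, tau n s t ≠ 0) :
    DiscreteCoupledKP lam mu z tau tauHat ↔
      IsWaveFunction lam mu z (coeffA (lam - mu) tau) (coeffB (lam - mu) tau)
        (coeffC (lam - mu) tau) (coeffD (lam - mu) tau)
        (fun n s t => (tau n s t)⁻¹ • tauHat n s t) := by
  have hk : lam - mu ≠ 0 := sub_ne_zero.2 hne
  set κ := lam - mu with hκ
  obtain ⟨ψ, hψ⟩ : ∃ ψ : ℕ → σ → σ → R, ψ = fun n s t => (tau n s t)⁻¹ • tauHat n s t := ⟨_, rfl⟩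
  rw [← hψ]
  have hat : ∀ n s t, tauHat n s t = tau n s t • ψ n s t := fun n s t => by
    rw [hψ, smul_inv_smul₀ (ht n s t)]
  have hatBelow : ∀ n s t, below tauHat n s t = below tau n s t • below ψ n s t := by
    rintro (_ | n) s t
    · simp [below]
    · exact hat n s t
  have iff_of_sub_eq_smul : ∀ {c : K} {x y x' y' : R}, c ≠ 0 →
      x - y = c • (x' - y') → (x = y ↔ x' = y') := by
    intro c x y x' y' hc h
    rw [← sub_eq_zero, h, smul_eq_zero_iff_right hc, sub_eq_zero]
  have e2 : ∀ n s t, (_ ↔ _) := fun n s t =>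
    iff_of_sub_eq_smul (c := κ * tau (n + 1) s t * tau n (s + 1) (t + 1))
      (x := shiftBy z mu * shiftBy z lam * ((κ * tau (n + 1) s t) • tauHat n (s + 1) (t + 1)))
      (y := shiftBy z lam * (tau (n + 1) (s + 1) t • tauHat n s (t + 1))
        - shiftBy z mu * (tau (n + 1) s (t + 1) • tauHat n (s + 1) t)
        + (κ * tau n (s + 1) (t + 1)) • tauHat (n + 1) s t)
      (x' := shiftBy z mu * shiftBy z lam * ψ n (s + 1) (t + 1) - ψ (n + 1) s t)
      (y' := shiftBy z lam * (coeffC κ tau n s t • ψ n s (t + 1))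
        - shiftBy z mu * (coeffD κ tau n s t • ψ n (s + 1) t))
      (mul_ne_zero (mul_ne_zero hk (ht _ _ _)) (ht _ _ _)) (by
        have hC : κ * tau (n + 1) s t * tau n (s + 1) (t + 1) * coeffC κ tau n s t
            = tau (n + 1) (s + 1) t * tau n s (t + 1) := by
          simp only [coeffC]
          field_simp [ht]
        have hD : κ * tau (n + 1) s t * tau n (s + 1) (t + 1) * coeffD κ tau n s t
            = tau (n + 1) s (t + 1) * tau n (s + 1) t := by
          simp only [coeffD]
          field_simp [ht]
        replace hC := congrArg (algebraMap K R) hC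
        replace hD := congrArg (algebraMap K R) hD
        simp only [hat, Algebra.smul_def, map_mul] at hC hD ⊢
        linear_combination shiftBy z lam * ψ n s (t + 1) * hC
          - shiftBy z mu * ψ n (s + 1) t * hD)
  have e1 : ∀ n s t, (_ ↔ _) := fun n s t =>
    iff_of_sub_eq_smul (c := tau n (s + 1) t * tau n s (t + 1))
      (x := (κ * tau n (s + 1) (t + 1)) • tauHat n s t)
      (y := shiftBy z mu * (tau n s (t + 1) • tauHat n (s + 1) t)
        - shiftBy z lam * (tau n (s + 1) t • tauHat n s (t + 1))
        + shiftBy z mu * shiftBy z lam *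
            ((κ * tau (n + 1) s t) • below tauHat n (s + 1) (t + 1)))
      (x' := shiftBy z lam * ψ n s (t + 1) - shiftBy z mu * ψ n (s + 1) t)
      (y' := shiftBy z mu * shiftBy z lam * (coeffA κ tau n s t • below ψ n (s + 1) (t + 1))
        - coeffB κ tau n s t • ψ n s t)
      (mul_ne_zero (ht _ _ _) (ht _ _ _)) (by
        have hA : tau n (s + 1) t * tau n s (t + 1) * coeffA κ tau n s t
            = κ * tau (n + 1) s t * below tau n (s + 1) (t + 1) := by
          simp only [coeffA]
          field_simp [ht]
        have hB : tau n (s + 1) t * tau n s (t + 1) * coeffB κ tau n s t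
            = κ * tau n s t * tau n (s + 1) (t + 1) := by
          simp only [coeffB]
          field_simp [ht]
        replace hA := congrArg (algebraMap K R) hA
        replace hB := congrArg (algebraMap K R) hB
        simp only [hat, hatBelow, Algebra.smul_def, map_mul] at hA hB ⊢
        linear_combination shiftBy z mu * shiftBy z lam * below ψ n (s + 1) (t + 1) * hA
          - ψ n s t * hB)
  exact ⟨fun h => ⟨fun n s t => (e1 n s t).1 (h.second n s t),
      fun n s t => (e2 n s t).1 (h.first n s t)⟩,
    fun h => ⟨fun n s t => (e2 n s t).2 (h.second n s t),
      fun n s t => (e1 n s t).2 (h.first n s t)⟩⟩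

theorem coeffA_mul_coeffC {κ : K} (hκ : κ ≠ 0) {tau : ℕ → σ → σ → K}
    (ht : ∀ n s t, tau n s t ≠ 0) (n : ℕ) (s t : σ) :
    coeffA κ tau (n + 1) (s + 1) t * coeffC κ tau n (s + 1) t
      = coeffA κ tau (n + 1) s t * coeffC κ tau (n + 1) s t := by
  simp only [coeffA, coeffC, below]
  field_simp [ht]

theorem coeffA_mul_coeffD {κ : K} (hκ : κ ≠ 0) {tau : ℕ → σ → σ → K}
    (ht : ∀ n s t, tau n s t ≠ 0) (n : ℕ) (s t : σ) :
    coeffA κ tau (n + 1) s (t + 1) * coeffD κ tau n s (t + 1)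
      = coeffA κ tau (n + 1) s t * coeffD κ tau (n + 1) s t := by
  simp only [coeffA, coeffD, below]
  field_simp [ht]

theorem coeffB_mul_coeffD {κ : K} (hκ : κ ≠ 0) {tau : ℕ → σ → σ → K}
    (ht : ∀ n s t, tau n s t ≠ 0) (n : ℕ) (s t : σ) :
    coeffB κ tau n (s + 1) t * coeffD κ tau n (s + 1) t
      = coeffB κ tau (n + 1) s t * coeffD κ tau n s t := by
  simp only [coeffB, coeffD]
  field_simp [ht]

theorem coeffB_mul_coeffC {κ : K} (hκ : κ ≠ 0) {tau : ℕ → σ → σ → K}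
    (ht : ∀ n s t, tau n s t ≠ 0) (n : ℕ) (s t : σ) :
    coeffB κ tau n s (t + 1) * coeffC κ tau n s (t + 1)
      = coeffB κ tau (n + 1) s t * coeffC κ tau n s t := by
  simp only [coeffB, coeffC]
  field_simp [ht]

/-- For coefficients that come from `τ` the multiplicative equations of the lattice are identities.
The compatibility relation of the Lax pair then reduces to its first term, so that the additive
equation follows without general position. -/
theorem IsWaveFunction.discretePfaffLattice_coeff {lam mu κ : K} (hκ : κ ≠ 0) {z : R}
    {tau : ℕ → σ → σ → K} (ht : ∀ n s t, tau n s t ≠ 0) {q : ℕ → σ → σ → R}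
    (hq : IsWaveFunction lam mu z (coeffA κ tau) (coeffB κ tau) (coeffC κ tau) (coeffD κ tau) q)
    (hz : ∀ n s t, shiftBy z mu * shiftBy z lam * q n (s + 1) (t + 1) ≠ 0) :
    DiscretePfaffLattice (coeffA κ tau) (coeffB κ tau) (coeffC κ tau) (coeffD κ tau) := by
  have hA : ∀ s t, coeffA κ tau 0 s t = 0 := fun s t => by simp [coeffA, below]
  refine ⟨hA, ?_, coeffA_mul_coeffC hκ ht, coeffA_mul_coeffD hκ ht, coeffB_mul_coeffD hκ ht,
    coeffB_mul_coeffC hκ ht⟩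
  rintro (_ | n) s t
  · have h := hq.relation_zero s t
    rw [sub_eq_zero.2 (coeffB_mul_coeffC hκ ht 0 s t),
      sub_eq_zero.2 (coeffB_mul_coeffD hκ ht 0 s t).symm, zero_smul, zero_smul, add_zero, add_zero,
      smul_eq_zero_iff_left (hz 0 s t)] at h
    rw [hA]
    linear_combination h
  · have h := hq.relation_succ n s t
    rw [sub_eq_zero.2 (coeffB_mul_coeffC hκ ht (n + 1) s t),
      sub_eq_zero.2 (coeffB_mul_coeffD hκ ht (n + 1) s t).symm,
      sub_eq_zero.2 (coeffA_mul_coeffC hκ ht n s (t + 1)),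
      sub_eq_zero.2 (coeffA_mul_coeffD hκ ht n (s + 1) t).symm,
      zero_smul, zero_smul, zero_smul, zero_smul, add_zero, add_zero, add_zero, add_zero,
      smul_eq_zero_iff_left (hz (n + 1) s t)] at h
    linear_combination h

theorem DiscreteCoupledKP.discretePfaffLattice {lam mu : K} (hne : lam ≠ mu) {z : R}
    {tau : ℕ → σ → σ → K} {tauHat : ℕ → σ → σ → R} (ht : ∀ n s t, tau n s t ≠ 0)
    (h : DiscreteCoupledKP lam mu z tau tauHat)
    (hz : ∀ n s t, shiftBy z mu * shiftBy z lam * tauHat n (s + 1) (t + 1) ≠ 0) :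
    DiscretePfaffLattice (coeffA (lam - mu) tau) (coeffB (lam - mu) tau)
      (coeffC (lam - mu) tau) (coeffD (lam - mu) tau) := by
  refine ((discreteCoupledKP_iff hne z tauHat ht).1 h).discretePfaffLattice_coeff
    (sub_ne_zero.2 hne) ht fun n s t => ?_
  rw [mul_smul_comm]
  exact smul_ne_zero (inv_ne_zero (ht _ _ _)) (hz n s t)

theorem DiscretePfaffLattice.neg {A B C D : ℕ → σ → σ → K} (h : DiscretePfaffLattice A B C D) :
    DiscretePfaffLattice (-A) (-B) (-C) (-D) := by
  refine ⟨fun s t => ?_, fun n s t => ?_, fun n s t => ?_, fun n s t => ?_, fun n s t => ?_,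
    fun n s t => ?_⟩ <;> simp only [Pi.neg_apply]
  · rw [h.boundary, neg_zero]
  · linear_combination -h.additive n s t
  · linear_combination h.mulAC n s t
  · linear_combination h.mulAD n s t
  · linear_combination h.mulBD n s t
  · linear_combination h.mulBC n s t

theorem discretePfaffLattice_coeff_neg {κ : K} {tau : ℕ → σ → σ → K}
    (h : DiscretePfaffLattice (coeffA κ tau) (coeffB κ tau) (coeffC κ tau) (coeffD κ tau)) :
    DiscretePfaffLattice (coeffA (-κ) tau) (coeffB (-κ) tau) (coeffC (-κ) tau)
      (coeffD (-κ) tau) := by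
  convert! h.neg using 1 <;> funext n s t <;>
    simp [coeffA, coeffB, coeffC, coeffD, inv_neg]

end CoupledKP

/-! ### Shifted skew-inner products -/

section SkewLattice

variable {K : Type*} [Field K]

namespace IsMonicSOP

variable {b b' : K[X] →ₗ[K] K[X] →ₗ[K] K} {q q' : ℕ → K[X]} {c : K}

/-- The shifted polynomial `(z - c) q'_{2n}` is orthogonal to all multiples of `z - c` of degree at
most `2n + 1`, so that pairing with it only sees the value at `c`. -/
theorem pair_shift (hb : ∀ f g, b' f g = b ((X - C c) * f) ((X - C c) * g))
    (h' : IsMonicSOP b' q') (n : ℕ) {g : K[X]} (hg : g.degree < (2 * n + 2 : ℕ)) :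
    b ((X - C c) * q' (2 * n)) g = g.eval c * b ((X - C c) * q' (2 * n)) 1 := by
  obtain ⟨f, hf⟩ := X_sub_C_dvd_sub_C_eval (p := g) (a := c)
  have hf' : f.degree < (2 * n + 1 : ℕ) := by
    refine degree_lt_of_X_sub_C_mul (c := c) ?_
    rw [← hf]
    refine (degree_sub_le _ _).trans_lt (max_lt hg (degree_C_le.trans_lt ?_))
    exact_mod_cast (by omega)
  have : g = (X - C c) * f + g.eval c • 1 := by
    rw [← hf, smul_eq_C_mul]
    ring
  conv_lhs => rw [this]
  rw [map_add, ← hb, h'.pair_even_of_lt n hf', map_smul, zero_add, smul_eq_mul]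

/-- `q_{2n}(c) ρ_n = -r_n` for `ρ_n = ⟨(z - c) q'_{2n} | 1⟩`. -/
theorem eval_mul_pair_shift (hs : IsSkew b) (h : IsMonicSOP b q) (h' : IsMonicSOP b' q')
    (hb : ∀ f g, b' f g = b ((X - C c) * f) ((X - C c) * g)) (n : ℕ) :
    (q (2 * n)).eval c * b ((X - C c) * q' (2 * n)) 1 = -b (q (2 * n)) (q (2 * n + 1)) := by
  rw [← h'.pair_shift hb n (by rw [h.degree_eq]; exact_mod_cast (by omega)), hs,
    h.pair_even n]
  · have hm : ((X - C c) * q' (2 * n)).Monic := (monic_X_sub_C c).mul (h'.monic _)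
    have hd : ((X - C c) * q' (2 * n)).natDegree = 2 * n + 1 := by
      rw [(monic_X_sub_C c).natDegree_mul (h'.monic _), natDegree_X_sub_C, h'.natDegree, add_comm]
    have : ((X - C c) * q' (2 * n)).coeff (2 * n + 1) = 1 := by
      rwa [Monic, leadingCoeff, hd] at hm
    rw [this, one_mul]
  · refine degree_X_sub_C_mul_lt ?_
    rw [h'.degree_eq]
    exact_mod_cast (by omega)

theorem eval_ne_zero (hs : IsSkew b) (h : IsMonicSOP b q) (h' : IsMonicSOP b' q')
    (hb : ∀ f g, b' f g = b ((X - C c) * f) ((X - C c) * g)) (n : ℕ) :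
    (q (2 * n)).eval c ≠ 0 := by
  intro h0
  have := h.eval_mul_pair_shift hs h' hb n
  rw [h0, zero_mul, eq_comm, neg_eq_zero] at this
  exact h.norm_ne_zero n this

theorem pair_shift_ne_zero (hs : IsSkew b) (h : IsMonicSOP b q) (h' : IsMonicSOP b' q')
    (hb : ∀ f g, b' f g = b ((X - C c) * f) ((X - C c) * g)) (n : ℕ) :
    b ((X - C c) * q' (2 * n)) 1 ≠ 0 := by
  intro h0
  have := h.eval_mul_pair_shift hs h' hb n
  rw [h0, mul_zero, eq_comm, neg_eq_zero] at this
  exact h.norm_ne_zero n this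

/-- `q_{2n+2}(c) ρ_n = -r'_n`, from `⟨(z - c) q'_{2n} | q_{2n+2}⟩ = 0`. -/
theorem eval_succ_mul_pair_shift (hs : IsSkew b) (h : IsMonicSOP b q) (h' : IsMonicSOP b' q')
    (hb : ∀ f g, b' f g = b ((X - C c) * f) ((X - C c) * g)) (n : ℕ) :
    (q (2 * (n + 1))).eval c * b ((X - C c) * q' (2 * n)) 1
      = -b' (q' (2 * n)) (q' (2 * n + 1)) := by
  obtain ⟨f, hf⟩ := X_sub_C_dvd_sub_C_eval (p := q (2 * (n + 1))) (a := c)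
  have hq : q (2 * (n + 1)) = (X - C c) * f + (q (2 * (n + 1))).eval c • 1 := by
    rw [← hf, smul_eq_C_mul]
    ring
  have hdeg : f.degree < (2 * n + 2 : ℕ) := by
    refine degree_lt_of_X_sub_C_mul (c := c) ?_
    rw [← hf]
    refine (degree_sub_le _ _).trans_lt (max_lt ?_ (degree_C_le.trans_lt ?_))
    · rw [h.degree_eq]
      exact_mod_cast (by omega)
    · exact_mod_cast (by omega)
  have hlead : f.coeff (2 * n + 1) = 1 := by
    have h1 := congrArg (fun g => coeff g (2 * n + 1 + 1)) hq
    have h2 : (q (2 * (n + 1))).coeff (2 * n + 1 + 1) = 1 := by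
      have := h.monic (2 * (n + 1))
      rwa [Monic, leadingCoeff, h.natDegree] at this
    have h3 : f.coeff (2 * n + 1 + 1) = 0 := by
      rw [degree_lt_iff_coeff_zero] at hdeg
      exact hdeg _ le_rfl
    simp only [coeff_add, sub_mul, coeff_sub, coeff_X_mul, coeff_C_mul, coeff_smul, coeff_one,
      h2, h3] at h1
    simpa using h1.symm
  have h1 : b ((X - C c) * q' (2 * n)) (q (2 * (n + 1))) = 0 := by
    rw [hs, h.pair_even_of_lt (n + 1), neg_zero]
    refine degree_X_sub_C_mul_lt ?_
    rw [h'.degree_eq]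
    exact_mod_cast (by omega)
  rw [hq, map_add, map_smul, ← hb, h'.pair_even n hdeg, hlead, smul_eq_mul] at h1
  linear_combination h1

theorem q_zero (h : IsMonicSOP b q) : q 0 = 1 :=
  (h.monic 0).natDegree_eq_zero.1 (h.natDegree 0)

variable [CharZero K]

/-- The value of `q_{2n}` at `c` is the ratio of the `τ`-functions of the shifted and the original
form, since both change by `r'_n / r_n` from `n` to `n + 1`. -/
theorem eval_mul_pfTau (hs : IsSkew b) (h : IsMonicSOP b q) (hs' : IsSkew b')
    (h' : IsMonicSOP b' q')
    (hb : ∀ f g, b' f g = b ((X - C c) * f) ((X - C c) * g)) (n : ℕ) :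
    (q (2 * n)).eval c * pfTau b n = pfTau b' n := by
  induction n with
  | zero => simp [pfTau_zero, h.q_zero]
  | succ n ih =>
    have h1 := h.eval_mul_pair_shift hs h' hb n
    have h2 := h.eval_succ_mul_pair_shift hs h' hb n
    rw [h.pfTau_succ hs, h'.pfTau_succ hs', ← ih]
    linear_combination (q (2 * (n + 1))).eval c * pfTau b n * h1
      - (q (2 * n)).eval c * pfTau b n * h2

/-- `ρ_n = -τ_{n+1} / τ'_n`. -/
theorem pair_shift_mul_pfTau (hs : IsSkew b) (h : IsMonicSOP b q) (hs' : IsSkew b')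
    (h' : IsMonicSOP b' q')
    (hb : ∀ f g, b' f g = b ((X - C c) * f) ((X - C c) * g)) (n : ℕ) :
    b ((X - C c) * q' (2 * n)) 1 * pfTau b' n = -pfTau b (n + 1) := by
  have h1 := h.eval_mul_pair_shift hs h' hb n
  rw [← h.eval_mul_pfTau hs hs' h' hb, h.pfTau_succ hs]
  linear_combination pfTau b n * h1

end IsMonicSOP

end SkewLattice

/-! ### The Lax pair in a cell of the lattice -/

section Square

variable {K : Type*} [Field K]

/-- The four forms at the corners of a cell of the lattice, with their monic skew orthogonal
polynomials: `b` at `(s, t)`, `b₁` at `(s + 1, t)`, `b₂` at `(s, t + 1)` and `b₃` at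
`(s + 1, t + 1)`. -/
structure IsShiftSquare (lam mu : K) (b b₁ b₂ b₃ : K[X] →ₗ[K] K[X] →ₗ[K] K)
    (q q₁ q₂ q₃ : ℕ → K[X]) : Prop where
  skew : IsSkew b
  skew₁ : IsSkew b₁
  skew₂ : IsSkew b₂
  skew₃ : IsSkew b₃
  sop : IsMonicSOP b q
  sop₁ : IsMonicSOP b₁ q₁
  sop₂ : IsMonicSOP b₂ q₂
  sop₃ : IsMonicSOP b₃ q₃
  shift₁ : ∀ f g, b₁ f g = b ((X - C mu) * f) ((X - C mu) * g)
  shift₂ : ∀ f g, b₂ f g = b ((X - C lam) * f) ((X - C lam) * g)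
  shift₁₃ : ∀ f g, b₃ f g = b₁ ((X - C lam) * f) ((X - C lam) * g)
  shift₂₃ : ∀ f g, b₃ f g = b₂ ((X - C mu) * f) ((X - C mu) * g)

namespace IsShiftSquare

variable {lam mu : K} {b b₁ b₂ b₃ : K[X] →ₗ[K] K[X] →ₗ[K] K} {q q₁ q₂ q₃ : ℕ → K[X]}

theorem shift₃ (S : IsShiftSquare lam mu b b₁ b₂ b₃ q q₁ q₂ q₃) (f g : K[X]) :
    b₃ f g = b ((X - C mu) * ((X - C lam) * f)) ((X - C mu) * ((X - C lam) * g)) := by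
  rw [S.shift₁₃, S.shift₁]

theorem second_lax (S : IsShiftSquare lam mu b b₁ b₂ b₃ q q₁ q₂ q₃) (hne : lam ≠ mu) (n : ℕ)
    {γ δ : K} (hγ : γ * ((mu - lam) * (q₂ (2 * n)).eval mu) = -(q (2 * (n + 1))).eval mu)
    (hδ : δ * ((lam - mu) * (q₁ (2 * n)).eval lam) = (q (2 * (n + 1))).eval lam) :
    (X - C mu) * (X - C lam) * q₃ (2 * n) - q (2 * (n + 1))
      = (X - C lam) * (γ • q₂ (2 * n)) - (X - C mu) * (δ • q₁ (2 * n)) := by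
  set E : K[X] := (X - C mu) * ((X - C lam) * q₃ (2 * n)) - q (2 * (n + 1))
    - γ • ((X - C lam) * q₂ (2 * n)) + δ • ((X - C mu) * q₁ (2 * n)) with hE
  suffices h0 : E = 0 by
    simp only [smul_eq_C_mul] at hE ⊢
    linear_combination h0 - hE
  have hmem : E ∈ degreeLT K (2 * n + 2) := by
    refine add_mem (sub_mem ?_ (Submodule.smul_mem _ _ ?_)) (Submodule.smul_mem _ _ ?_)
    · refine sub_mem_degreeLT
        (monic_X_sub_C_mul _ (monic_X_sub_C_mul _ (S.sop₃.monic _))) (S.sop.monic _) ?_ ?_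
      · rw [natDegree_X_sub_C_mul _ (monic_X_sub_C_mul _ (S.sop₃.monic _)),
          natDegree_X_sub_C_mul _ (S.sop₃.monic _), S.sop₃.natDegree]
      · rw [S.sop.natDegree]
        ring
    · exact mem_degreeLT_X_sub_C_mul _ (S.sop₂.mem_degreeLT (by omega))
    · exact mem_degreeLT_X_sub_C_mul _ (S.sop₁.mem_degreeLT (by omega))
  obtain ⟨f, hf, hEf⟩ := exists_eq_mul_mul hne hmem (by simp [hE]; linear_combination -hγ)
    (by simp [hE]; linear_combination hδ)
  have : f = 0 := by
    refine S.sop₃.eq_zero_of_forall_pair S.skew₃ n hf fun g hg => ?_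
    have hlam := degree_X_sub_C_mul_lt (c := lam) hg
    have hmu := degree_X_sub_C_mul_lt (c := mu) hg
    have hboth := degree_X_sub_C_mul_lt (c := mu) hlam
    rw [S.shift₃, ← hEf, hE, map_add, map_sub, map_sub, map_smul, map_smul]
    simp only [LinearMap.add_apply, LinearMap.sub_apply, LinearMap.smul_apply]
    rw [← S.shift₃, S.sop₃.pair_even_of_lt n (hg.trans (by exact_mod_cast (by omega))),
      S.sop.pair_even_of_lt (n + 1) (hboth.trans (by exact_mod_cast (by omega))),
      ← S.shift₁, S.sop₁.pair_even_of_lt n hlam, mul_left_comm (X - C mu), ← S.shift₂,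
      S.sop₂.pair_even_of_lt n hmu]
    simp
  rw [hEf, this, mul_zero, mul_zero]

theorem first_lax_zero (S : IsShiftSquare lam mu b b₁ b₂ b₃ q q₁ q₂ q₃) :
    (X - C lam) * q₂ 0 - (X - C mu) * q₁ 0 = -((lam - mu) • q 0) := by
  rw [S.sop.q_zero, S.sop₁.q_zero, S.sop₂.q_zero, smul_eq_C_mul, C_sub]
  ring

theorem first_lax_succ (S : IsShiftSquare lam mu b b₁ b₂ b₃ q q₁ q₂ q₃) (hne : lam ≠ mu) (n : ℕ)
    {α β : K}
    (hα : α * b₂ ((X - C mu) * q₃ (2 * n)) 1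
      = (lam - mu) * b ((X - C mu) * q₁ (2 * (n + 1))) 1)
    (hβ : β * (q (2 * (n + 1))).eval mu = (lam - mu) * (q₂ (2 * (n + 1))).eval mu)
    (hβ' : β * (q (2 * (n + 1))).eval lam = (lam - mu) * (q₁ (2 * (n + 1))).eval lam) :
    (X - C lam) * q₂ (2 * (n + 1)) - (X - C mu) * q₁ (2 * (n + 1))
      = (X - C mu) * (X - C lam) * (α • q₃ (2 * n)) - β • q (2 * (n + 1)) := by
  set E : K[X] := (X - C lam) * q₂ (2 * (n + 1)) - (X - C mu) * q₁ (2 * (n + 1))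
    - α • ((X - C mu) * ((X - C lam) * q₃ (2 * n))) + β • q (2 * (n + 1)) with hE
  suffices h0 : E = 0 by
    simp only [smul_eq_C_mul] at hE ⊢
    linear_combination h0 - hE
  have hmem : E ∈ degreeLT K (2 * n + 1 + 2) := by
    refine add_mem (sub_mem ?_ (Submodule.smul_mem _ _ ?_)) (Submodule.smul_mem _ _ ?_)
    · refine sub_mem_degreeLT
        (monic_X_sub_C_mul _ (S.sop₂.monic _)) (monic_X_sub_C_mul _ (S.sop₁.monic _)) ?_ ?_
      · rw [natDegree_X_sub_C_mul _ (S.sop₂.monic _), S.sop₂.natDegree]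
        ring
      · rw [natDegree_X_sub_C_mul _ (S.sop₁.monic _), S.sop₁.natDegree]
        ring
    · exact mem_degreeLT_X_sub_C_mul _ (mem_degreeLT_X_sub_C_mul _ (S.sop₃.mem_degreeLT (by omega)))
    · exact S.sop.mem_degreeLT (by omega)
  obtain ⟨f, hf, hEf⟩ := exists_eq_mul_mul hne hmem (by simp [hE]; linear_combination hβ)
    (by simp [hE]; linear_combination hβ')
  -- `f` lies in the radical of `b₃` on the polynomials of degree at most `2 * n`
  have hfq := S.sop₃.eq_smul_of_forall_pair S.skew₃ n hf fun g hg => by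
    have hlam := degree_X_sub_C_mul_lt (c := lam) hg
    have hmu := degree_X_sub_C_mul_lt (c := mu) hg
    have hboth := degree_X_sub_C_mul_lt (c := mu) hlam
    rw [S.shift₃, ← hEf, hE, map_add, map_sub, map_sub, map_smul, map_smul]
    simp only [LinearMap.add_apply, LinearMap.sub_apply, LinearMap.smul_apply]
    rw [← S.shift₃, S.sop₃.pair_even_of_lt n (hg.trans (by exact_mod_cast (by omega))),
      S.sop.pair_even_of_lt (n + 1) (hboth.trans (by exact_mod_cast (by omega))),
      ← S.shift₁,
      S.sop₁.pair_even_of_lt (n + 1) (hlam.trans (by exact_mod_cast (by omega))),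
      mul_left_comm (X - C mu), ← S.shift₂,
      S.sop₂.pair_even_of_lt (n + 1) (hmu.trans (by exact_mod_cast (by omega)))]
    simp
  -- pairing with `z - lam` shows that the remaining coefficient vanishes
  have hone : (1 : K[X]).degree < ((2 * (n + 1) + 1 : ℕ) : WithBot ℕ) := by
    rw [degree_one]
    exact_mod_cast (by omega)
  have hlin : (X - C lam).degree < ((2 * (n + 1) + 1 : ℕ) : WithBot ℕ) := by
    rw [degree_X_sub_C]
    exact_mod_cast (by omega)
  have hpair : b E (X - C lam) = 0 := by
    have h1 : b ((X - C lam) * q₂ (2 * (n + 1))) (X - C lam) = 0 := by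
      have := S.sop₂.pair_even_of_lt (n + 1) hone
      rwa [S.shift₂, mul_one] at this
    have h2 : b ((X - C mu) * ((X - C lam) * q₃ (2 * n))) (X - C lam)
        = b₂ ((X - C mu) * q₃ (2 * n)) 1 := by
      rw [S.shift₂, mul_one, mul_left_comm]
    rw [hE, map_add b, map_sub b, map_sub b, map_smul, map_smul]
    simp only [LinearMap.add_apply, LinearMap.sub_apply, LinearMap.smul_apply]
    rw [h1, h2, S.sop.pair_even_of_lt (n + 1) hlin,
      S.sop₁.pair_shift S.shift₁ (n + 1) (hlin.trans (by exact_mod_cast (by omega)))]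
    simp only [eval_sub, eval_X, eval_C, smul_eq_mul]
    linear_combination -hα
  have hcoeff : f.coeff (2 * n) = 0 := by
    rw [hEf, hfq, mul_smul_comm, mul_smul_comm, map_smul, LinearMap.smul_apply,
      mul_left_comm (X - C mu)] at hpair
    have h3 : b ((X - C lam) * ((X - C mu) * q₃ (2 * n))) (X - C lam)
        = b₂ ((X - C mu) * q₃ (2 * n)) 1 := by
      rw [S.shift₂, mul_one]
    rw [h3, smul_eq_mul, mul_eq_zero] at hpair
    exact hpair.resolve_right (S.sop₂.pair_shift_ne_zero S.skew₂ S.sop₃ S.shift₂₃ n)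
  rw [hEf, hfq, hcoeff, zero_smul, mul_zero, mul_zero]

end IsShiftSquare

end Square

/-! ### The Pfaffian solution -/

section Solution

variable {K : Type*} [Field K] {σ : Type*} [Add σ] [One σ]

/-- A family of skew-inner products, related by the shifts of the lattice, with their monic skew
orthogonal polynomials. -/
structure IsShiftFamily (lam mu : K) (b : σ → σ → K[X] →ₗ[K] K[X] →ₗ[K] K)
    (q : σ → σ → ℕ → K[X]) : Prop where
  skew : ∀ s t, IsSkew (b s t)
  shift₁ : ∀ s t f g, b (s + 1) t f g = b s t ((X - C mu) * f) ((X - C mu) * g)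
  shift₂ : ∀ s t f g, b s (t + 1) f g = b s t ((X - C lam) * f) ((X - C lam) * g)
  sop : ∀ s t, IsMonicSOP (b s t) (q s t)

namespace IsShiftFamily

variable {lam mu : K} {b : σ → σ → K[X] →ₗ[K] K[X] →ₗ[K] K} {q : σ → σ → ℕ → K[X]}

theorem square (F : IsShiftFamily lam mu b q) (s t : σ) :
    IsShiftSquare lam mu (b s t) (b (s + 1) t) (b s (t + 1)) (b (s + 1) (t + 1))
      (q s t) (q (s + 1) t) (q s (t + 1)) (q (s + 1) (t + 1)) :=
  ⟨F.skew _ _, F.skew _ _, F.skew _ _, F.skew _ _, F.sop _ _, F.sop _ _, F.sop _ _, F.sop _ _,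
    F.shift₁ _ _, F.shift₂ _ _, F.shift₂ _ _, F.shift₁ _ _⟩

theorem eval_mu_ne_zero (F : IsShiftFamily lam mu b q) (n : ℕ) (s t : σ) :
    (q s t (2 * n)).eval mu ≠ 0 :=
  (F.sop s t).eval_ne_zero (F.skew s t) (F.sop (s + 1) t) (F.shift₁ s t) n

theorem eval_lam_ne_zero (F : IsShiftFamily lam mu b q) (n : ℕ) (s t : σ) :
    (q s t (2 * n)).eval lam ≠ 0 :=
  (F.sop s t).eval_ne_zero (F.skew s t) (F.sop s (t + 1)) (F.shift₂ s t) n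

/-- The first coefficient of a linear relation vanishes by degree; evaluation at `mu` and at `lam`
then isolates the others. -/
theorem inGeneralPosition (F : IsShiftFamily lam mu b q) (hne : lam ≠ mu) :
    InGeneralPosition lam mu (X : K[X]) (fun n s t => q s t (2 * n)) := by
  have hX : ∀ c : K, shiftBy (X : K[X]) c = X - C c := fun c => rfl
  have h1 : lam - mu ≠ 0 := sub_ne_zero.2 hne
  have h2 : mu - lam ≠ 0 := sub_ne_zero.2 hne.symm
  -- the first polynomial has larger degree than all the others
  have top : ∀ (x : K) (n : ℕ) (s t : σ) (f : K[X]), f ∈ degreeLT K (n + 2) →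
      x • ((X - C mu) * (X - C lam) * q s t n) + f = 0 → x = 0 := by
    intro x n s t f hf h
    have hm := monic_X_sub_C_mul mu
      (monic_X_sub_C_mul lam ((F.sop s t).monic n))
    have hd : ((X - C mu) * ((X - C lam) * q s t n)).natDegree = n + 2 := by
      rw [natDegree_X_sub_C_mul _
          (monic_X_sub_C_mul _ ((F.sop s t).monic _)),
        natDegree_X_sub_C_mul _ ((F.sop s t).monic _), (F.sop s t).natDegree]
    have hc : ((X - C mu) * ((X - C lam) * q s t n)).coeff (n + 2) = 1 := by
      rwa [Monic, leadingCoeff, hd] at hm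
    rw [mem_degreeLT, degree_lt_iff_coeff_zero] at hf
    have := congrArg (fun g => coeff g (n + 2)) h
    simpa only [mul_assoc, coeff_add, coeff_smul, hc, hf _ le_rfl, smul_eq_mul, mul_one, add_zero,
      coeff_zero] using this
  have hmem : ∀ (c : K) (n : ℕ) (s t : σ), (X - C c) * q s t n ∈ degreeLT K (n + 2) :=
    fun c n s t => mem_degreeLT_X_sub_C_mul _ ((F.sop s t).mem_degreeLT (by omega))
  refine ⟨fun s t => ?_, fun n s t => ?_⟩
  · rw [Fintype.linearIndependent_iff]
    intro x hx
    simp only [Fin.sum_univ_three, hX, Matrix.cons_val_zero, Matrix.cons_val_one,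
      Matrix.cons_val] at hx
    have hx0 := top (x 0) _ (s + 1) (t + 1) _
      (add_mem (Submodule.smul_mem _ (x 1) (hmem lam (2 * 0) s (t + 1)))
      (Submodule.smul_mem _ (x 2) (hmem mu (2 * 0) (s + 1) t))) (by rw [← hx, add_assoc])
    have e1 := congrArg (eval mu) hx
    have e2 := congrArg (eval lam) hx
    have v1 := F.eval_mu_ne_zero 0 s (t + 1)
    have v2 := F.eval_lam_ne_zero 0 (s + 1) t
    rw [mul_zero] at v1 v2
    simp only [eval_add, eval_smul, eval_mul, eval_sub, eval_X, eval_C, sub_self, zero_mul,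
      mul_zero, smul_eq_mul, add_zero, zero_add, eval_zero, mul_eq_zero, h1, h2, v1, v2,
      or_false] at e1 e2
    intro i
    fin_cases i
    exacts [hx0, e1, e2]
  · rw [Fintype.linearIndependent_iff]
    intro x hx
    simp only [Fin.sum_univ_five, hX, Matrix.cons_val_zero, Matrix.cons_val_one,
      Matrix.cons_val] at hx
    have m3 : (X - C mu) * (X - C lam) ^ 2 * q (s + 1) (t + 1 + 1) (2 * n)
        ∈ degreeLT K (2 * (n + 1) + 2) := by
      have := mem_degreeLT_X_sub_C_mul mu (mem_degreeLT_X_sub_C_mul lam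
        (hmem lam (2 * n) (s + 1) (t + 1 + 1)))
      rwa [← mul_assoc, ← mul_assoc, mul_assoc (X - C mu) (X - C lam), ← sq] at this
    have m4 : (X - C mu) ^ 2 * (X - C lam) * q (s + 1 + 1) (t + 1) (2 * n)
        ∈ degreeLT K (2 * (n + 1) + 2) := by
      have := mem_degreeLT_X_sub_C_mul mu (mem_degreeLT_X_sub_C_mul lam
        (hmem mu (2 * n) (s + 1 + 1) (t + 1)))
      rwa [mul_left_comm (X - C lam), ← mul_assoc, ← mul_assoc, ← sq] at this
    have hx0 := top (x 0) _ (s + 1) (t + 1) _ (add_mem (add_mem (add_mem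
      (Submodule.smul_mem _ (x 1) (hmem lam (2 * (n + 1)) s (t + 1)))
      (Submodule.smul_mem _ (x 2) (hmem mu (2 * (n + 1)) (s + 1) t)))
      (Submodule.smul_mem _ (x 3) m3)) (Submodule.smul_mem _ (x 4) m4))
      (by rw [← hx]; simp only [add_assoc])
    have e1 := congrArg (eval mu) hx
    have e2 := congrArg (eval lam) hx
    have v1 := F.eval_mu_ne_zero (n + 1) s (t + 1)
    have v2 := F.eval_lam_ne_zero (n + 1) (s + 1) t
    simp only [eval_add, eval_smul, eval_mul, eval_sub, eval_X, eval_C, eval_pow, sub_self,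
      zero_mul, mul_zero, smul_eq_mul, add_zero, zero_add, eval_zero, mul_eq_zero, h1, h2, v1, v2,
      or_false, ne_eq, OfNat.ofNat_ne_zero, not_false_eq_true, zero_pow] at e1 e2
    rw [hx0, e1, e2] at hx
    -- what remains is divisible by `(z - mu) (z - lam)`; the quotient is treated in the same way
    have hrest : (X - C mu) * (X - C lam) * (x 3 • ((X - C lam) * q (s + 1) (t + 1 + 1) (2 * n))
        + x 4 • ((X - C mu) * q (s + 1 + 1) (t + 1) (2 * n))) = 0 := by
      rw [← hx]
      simp only [smul_eq_C_mul, C_0]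
      ring
    have hrest' := (mul_eq_zero.1 hrest).resolve_left
      (mul_ne_zero (X_sub_C_ne_zero mu) (X_sub_C_ne_zero lam))
    have e3 := congrArg (eval mu) hrest'
    have e4 := congrArg (eval lam) hrest'
    have v3 := F.eval_mu_ne_zero n (s + 1) (t + 1 + 1)
    have v4 := F.eval_lam_ne_zero n (s + 1 + 1) (t + 1)
    simp only [eval_add, eval_smul, eval_mul, eval_sub, eval_X, eval_C, sub_self, zero_mul,
      mul_zero, smul_eq_mul, add_zero, zero_add, eval_zero, mul_eq_zero, h1, h2, v3, v4,
      or_false] at e3 e4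
    intro i
    fin_cases i
    exacts [hx0, e1, e2, e3, e4]

variable [CharZero K]

theorem pfTau_ne_zero (F : IsShiftFamily lam mu b q) (n : ℕ) (s t : σ) : pfTau (b s t) n ≠ 0 :=
  (F.sop s t).pfTau_ne_zero (F.skew s t) n

theorem eval_mu (F : IsShiftFamily lam mu b q) (n : ℕ) (s t : σ) :
    (q s t (2 * n)).eval mu = pfTau (b (s + 1) t) n / pfTau (b s t) n :=
  eq_div_of_mul_eq (F.pfTau_ne_zero n s t)
    ((F.sop s t).eval_mul_pfTau (F.skew s t) (F.skew _ _) (F.sop (s + 1) t) (F.shift₁ s t) n)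

theorem eval_lam (F : IsShiftFamily lam mu b q) (n : ℕ) (s t : σ) :
    (q s t (2 * n)).eval lam = pfTau (b s (t + 1)) n / pfTau (b s t) n :=
  eq_div_of_mul_eq (F.pfTau_ne_zero n s t)
    ((F.sop s t).eval_mul_pfTau (F.skew s t) (F.skew _ _) (F.sop s (t + 1)) (F.shift₂ s t) n)

theorem pair_shift_mu (F : IsShiftFamily lam mu b q) (n : ℕ) (s t : σ) :
    b s t ((X - C mu) * q (s + 1) t (2 * n)) 1
      = -pfTau (b s t) (n + 1) / pfTau (b (s + 1) t) n :=
  eq_div_of_mul_eq (F.pfTau_ne_zero n _ t)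
    ((F.sop s t).pair_shift_mul_pfTau (F.skew s t) (F.skew _ _) (F.sop (s + 1) t) (F.shift₁ s t) n)

theorem isWaveFunction (F : IsShiftFamily lam mu b q) (hne : lam ≠ mu) {tau : ℕ → σ → σ → K}
    (htau : ∀ n s t, tau n s t = pfTau (b s t) n) :
    IsWaveFunction lam mu (X : K[X]) (coeffA (lam - mu) tau) (coeffB (lam - mu) tau)
      (coeffC (lam - mu) tau) (coeffD (lam - mu) tau) (fun n s t => q s t (2 * n)) := by
  have hX : ∀ c : K, shiftBy (X : K[X]) c = X - C c := fun c => rfl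
  have h1 : lam - mu ≠ 0 := sub_ne_zero.2 hne
  have ht : ∀ n s t, tau n s t ≠ 0 := fun n s t => by rw [htau]; exact F.pfTau_ne_zero n s t
  refine ⟨?_, fun n s t => ?_⟩
  · rintro (_ | n) s t
    · have hB : coeffB (lam - mu) tau 0 s t = lam - mu := by
        simp [coeffB, htau, IsMonicSOP.pfTau_zero]
      have := (F.square s t).first_lax_zero
      simp only [hX, below, smul_zero, mul_zero, zero_sub, hB]
      exact this
    · simp only [hX, below]
      refine (F.square s t).first_lax_succ hne n ?_ ?_ ?_
      · simp only [F.pair_shift_mu, ← htau, coeffA, below]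
        field_simp [ht]
      · simp only [F.eval_mu, ← htau, coeffB]
        field_simp [ht]
      · simp only [F.eval_lam, ← htau, coeffB]
        field_simp [ht]
  · simp only [hX]
    refine (F.square s t).second_lax hne n ?_ ?_
    · simp only [F.eval_mu, ← htau, coeffC]
      field_simp [ht]
      ring
    · simp only [F.eval_lam, ← htau, coeffD]
      field_simp [ht]

theorem pfTauHat_eq (F : IsShiftFamily lam mu b q) (n : ℕ) (s t : σ) :
    pfTauHat (b s t) n = pfTau (b s t) n • q s t (2 * n) :=
  (F.sop s t).pfTauHat_eq (F.skew s t) n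

theorem discreteCoupledKP (F : IsShiftFamily lam mu b q) (hne : lam ≠ mu) {tau : ℕ → σ → σ → K}
    {tauHat : ℕ → σ → σ → K[X]} (htau : ∀ n s t, tau n s t = pfTau (b s t) n)
    (hhat : ∀ n s t, tauHat n s t = pfTauHat (b s t) n) :
    DiscreteCoupledKP lam mu (X : K[X]) tau tauHat := by
  have ht : ∀ n s t, tau n s t ≠ 0 := fun n s t => by rw [htau]; exact F.pfTau_ne_zero n s t
  rw [discreteCoupledKP_iff hne _ _ ht]
  convert F.isWaveFunction hne htau using 1
  funext n s t
  rw [hhat, F.pfTauHat_eq, ← htau, inv_smul_smul₀ (ht n s t)]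

theorem discretePfaffLattice (F : IsShiftFamily lam mu b q) (hne : lam ≠ mu)
    {tau : ℕ → σ → σ → K} (htau : ∀ n s t, tau n s t = pfTau (b s t) n) :
    DiscretePfaffLattice (coeffA (lam - mu) tau) (coeffB (lam - mu) tau)
      (coeffC (lam - mu) tau) (coeffD (lam - mu) tau) := by
  refine (F.isWaveFunction hne htau).discretePfaffLattice_coeff (sub_ne_zero.2 hne)
    (fun n s t => by rw [htau]; exact F.pfTau_ne_zero n s t) fun n s t => ?_
  exact mul_ne_zero (mul_ne_zero (X_sub_C_ne_zero mu) (X_sub_C_ne_zero lam))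
    ((F.sop _ _).monic _).ne_zero

end IsShiftFamily

end Solution

end SkewOrth

theorem theorem4 {K R σ : Type*} [Field K] [CharZero K] [CommRing R] [Algebra K R]
    [Add σ] [One σ] (lam mu : K) (hne : lam ≠ mu) :
    -- compatibility of the Lax pair yields the nonlinear system
    (∀ (z : R) (A B C D : ℕ → ℤ → ℤ → K) (q : ℕ → ℤ → ℤ → R),
      (∀ s t, A 0 s t = 0) →
      SkewOrth.IsWaveFunction lam mu z A B C D q →
      SkewOrth.InGeneralPosition lam mu z q →
      SkewOrth.DiscretePfaffLattice A B C D) ∧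
    -- conversely, the nonlinear system makes the Lax pair compatible
    (∀ (z : R) (A B C D : ℕ → ℤ → ℤ → K), SkewOrth.DiscretePfaffLattice A B C D →
      ∀ q₀ : ℤ → ℤ → R,
        (∀ s t, SkewOrth.shiftBy z lam * q₀ s (t + 1) - SkewOrth.shiftBy z mu * q₀ (s + 1) t
          = -(B 0 s t • q₀ s t)) →
        ∃! q : ℕ → ℤ → ℤ → R, q 0 = q₀ ∧ SkewOrth.IsWaveFunction lam mu z A B C D q) ∧
    -- the system is a nonlinear form of the discrete coupled KP equation
    (∀ (z : R) (tau : ℕ → σ → σ → K) (tauHat : ℕ → σ → σ → R), (∀ n s t, tau n s t ≠ 0) →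
      (SkewOrth.DiscreteCoupledKP lam mu z tau tauHat ↔
        SkewOrth.IsWaveFunction lam mu z
          (SkewOrth.coeffA (lam - mu) tau) (SkewOrth.coeffB (lam - mu) tau)
          (SkewOrth.coeffC (lam - mu) tau) (SkewOrth.coeffD (lam - mu) tau)
          (fun n s t => (tau n s t)⁻¹ • tauHat n s t)) ∧
      (SkewOrth.DiscreteCoupledKP lam mu z tau tauHat →
        (∀ n s t, SkewOrth.shiftBy z mu * SkewOrth.shiftBy z lam
          * tauHat n (s + 1) (t + 1) ≠ 0) →
        SkewOrth.DiscretePfaffLattice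
          (SkewOrth.coeffA (lam - mu) tau) (SkewOrth.coeffB (lam - mu) tau)
          (SkewOrth.coeffC (lam - mu) tau) (SkewOrth.coeffD (lam - mu) tau))) ∧
    -- the special Pfaffian solution
    (∀ (b : σ → σ → Polynomial K →ₗ[K] Polynomial K →ₗ[K] K)
      (q : σ → σ → ℕ → Polynomial K),
      (∀ s t, SkewOrth.IsSkew (b s t)) →
      (∀ s t f g, b (s + 1) t f g
        = b s t ((Polynomial.X - Polynomial.C mu) * f) ((Polynomial.X - Polynomial.C mu) * g)) →
      (∀ s t f g, b s (t + 1) f g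
        = b s t ((Polynomial.X - Polynomial.C lam) * f) ((Polynomial.X - Polynomial.C lam) * g)) →
      (∀ s t, SkewOrth.IsMonicSOP (b s t) (q s t)) →
      ∀ (tau : ℕ → σ → σ → K) (tauHat : ℕ → σ → σ → Polynomial K),
      (∀ n s t, tau n s t = SkewOrth.pfTau (b s t) n) →
      (∀ n s t, tauHat n s t = SkewOrth.pfTauHat (b s t) n) →
      (∀ n s t, tau n s t ≠ 0) ∧
      (∀ n s t, tauHat n s t = tau n s t • q s t (2 * n)) ∧
      SkewOrth.DiscreteCoupledKP lam mu (Polynomial.X : Polynomial K) tau tauHat ∧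
      SkewOrth.IsWaveFunction lam mu (Polynomial.X : Polynomial K)
        (SkewOrth.coeffA (lam - mu) tau) (SkewOrth.coeffB (lam - mu) tau)
        (SkewOrth.coeffC (lam - mu) tau) (SkewOrth.coeffD (lam - mu) tau)
        (fun n s t => q s t (2 * n)) ∧
      SkewOrth.InGeneralPosition lam mu (Polynomial.X : Polynomial K)
        (fun n s t => q s t (2 * n)) ∧
      SkewOrth.DiscretePfaffLattice
        (SkewOrth.coeffA (lam - mu) tau) (SkewOrth.coeffB (lam - mu) tau)
        (SkewOrth.coeffC (lam - mu) tau) (SkewOrth.coeffD (lam - mu) tau) ∧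
      SkewOrth.DiscretePfaffLattice
        (SkewOrth.coeffA (mu - lam) tau) (SkewOrth.coeffB (mu - lam) tau)
        (SkewOrth.coeffC (mu - lam) tau) (SkewOrth.coeffD (mu - lam) tau)) := by
  refine ⟨fun z A B C D q hA hq hg => hq.discretePfaffLattice hA hg,
    fun z A B C D h q₀ h0 => h.existsUnique_isWaveFunction h0,
    fun z tau tauHat ht => ⟨SkewOrth.discreteCoupledKP_iff hne z tauHat ht,
      fun h hz => h.discretePfaffLattice hne ht hz⟩, ?_⟩
  intro b q hs h₁ h₂ hq tau tauHat htau hhat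
  have F : SkewOrth.IsShiftFamily lam mu b q := ⟨hs, h₁, h₂, hq⟩
  have lattice := F.discretePfaffLattice hne htau
  refine ⟨fun n s t => ?_, fun n s t => ?_, F.discreteCoupledKP hne htau hhat,
    F.isWaveFunction hne htau, F.inGeneralPosition hne, lattice, ?_⟩
  · rw [htau]
    exact F.pfTau_ne_zero n s t
  · rw [hhat, htau]
    exact F.pfTauHat_eq n s t
  · rw [← neg_sub lam mu]
    exact SkewOrth.discretePfaffLattice_coeff_neg lattice
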